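/- **Definitions.** An *increasing tree* of size $n\ge 1$ is a planar rooted tree with $n$ nodes labeled $1,2,\dots,n$ (each label used once), with root labeled $1$, in which each node has at most one left child and at most one right child, and the label of each node is smaller than the labels of its children. The *rightmost node* is the node reached from the root by following right children as long as possible. An increasing tree of size $n$ is *complete* if every node is either a leaf or has two children, except that, when $n$ is even, the rightmost node has a left child but no right child. Let $\mathfrak T_n$ be the set of complete increasing trees of size $n$. For $t\in\mathfrak T_n$, let $\mathrm{eoc}(t)$ ("end of the minimal chain") be the label of the leaf reached from the root by moving, from each interior node, to its child of smaller label (its only child if it has just one). For $n\ge 2$ let $\mathrm{pom}(t)$ be the label of the parent of the leaf labeled $n$. For $2\le m\le 2n$ and $1\le k\le 2n-1$, where $n\ge1$, put $$f_{2n}(m,k)=\#\{t\in\mathfrak T_{2n}:\ \mathrm{eoc}(t)=m,\ \mathrm{pom}(t)=k\},$$ $$f_{2n}(m,\bullet)=\sum_{k=1}^{2n-1}f_{2n}(m,k),\qquad f_{2n}(\bullet,k)=\sum_{m=2}^{2n}f_{2n}(m,k).$$ **Theorem 1.2.** Let $n\ge 2$. Then 1. (first top row) $f_{2n}(2,k)=f_{2n-2}(\bullet,k-2)=f_{2n-2}(k-1,\bullet)$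 for $3\le k\le 2n-1$; 2. (second top row) $f_{2n}(3,k)=3f_{2n}(2,k)$ for $4\le k\le 2n-1$; 3. (rightmost column) $f_{2n}(m,2n-1)=f_{2n-2}(m,\bullet)=f_{2n-2}(\bullet,m-1)$ for $2\le m\le 2n-2$; 4. (next to rightmost column) $f_{2n}(m,2n-2)=3f_{2n}(m,2n-1)$ for $2\le m\le 2n-3$. -/

import Mathlib

namespace SecantTree

/-! Labeled planar binary trees are values of Mathlib's `BinaryTree ℕ`: `nil` is the empty subtree
(no child), and `node a l r` is a node labeled `a` with left subtree `l` and right subtree `r`.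
A leaf is `node a nil nil`. -/

/-- The label of the root, if the tree is non-empty. -/
def rootLabel? : BinaryTree ℕ → Option ℕ
  | .nil => none
  | .node a _ _ => some a

/-- The labels of a tree read from left to right (the projection of the nodes on a horizontal
axis). -/
def labels : BinaryTree ℕ → List ℕ
  | .nil => []
  | .node a l r => labels l ++ a :: labels r

/-- The label of each node is smaller than the labels of its children, if any. -/
def Increasing : BinaryTree ℕ → Prop
  | .nil => True
  | .node a l r =>
      (∀ b ∈ rootLabel? l, a < b) ∧ (∀ c ∈ rootLabel? r, a < c) ∧ Increasing l ∧ Increasing r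

/-- Every node is either a leaf or a node with two children. -/
def EveryNodeFull : BinaryTree ℕ → Prop
  | .nil => True
  | .node _ l r => (l = .nil ↔ r = .nil) ∧ EveryNodeFull l ∧ EveryNodeFull r

/-- The rightmost node (the one reached from the root by following right children as long as
possible) has a left child but no right child, and every other node is either a leaf or a node with
two children. -/
def FullExceptRightmost : BinaryTree ℕ → Prop
  | .nil => False
  | .node _ l r =>
      l ≠ .nil ∧ EveryNodeFull l ∧ (r = .nil ∨ FullExceptRightmost r)

/-- `t` is an increasing tree of size `n`: its nodes are labeled `1, 2, …, n` (each label being used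
once), the root is labeled `1`, and labels increase from parent to child. -/
def IsIncreasingTree (n : ℕ) (t : BinaryTree ℕ) : Prop :=
  (labels t).Perm (List.range' 1 n) ∧ rootLabel? t = some 1 ∧ Increasing t

/-- `t` is a complete increasing tree of size `n`: an increasing tree of size `n` in which every
node is a leaf or has two children, except that, when `n` is even, the rightmost node has a left
child and no right child. For even `n` these are the secant trees. -/
def IsCompleteIncreasing (n : ℕ) (t : BinaryTree ℕ) : Prop :=
  IsIncreasingTree n t ∧ if Even n then FullExceptRightmost t else EveryNodeFull t

/-- The end of the minimal chain: starting from the root, move from each interior node to its child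
of smaller label (to its only child if there is just one) until a leaf is reached. The value on the
empty tree is irrelevant. -/
def eoc : BinaryTree ℕ → ℕ
  | .nil => 0
  | .node a l r =>
      match rootLabel? l, rootLabel? r with
      | none, none => a
      | some _, none => eoc l
      | none, some _ => eoc r
      | some b, some c => if b < c then eoc l else eoc r

/-- The label of the parent of the node labeled `x`, if there is one. -/
def parent? (x : ℕ) : BinaryTree ℕ → Option ℕ
  | .nil => none
  | .node a l r =>
      if rootLabel? l = some x ∨ rootLabel? r = some x then some a
      else (parent? x l).or (parent? x r)

/-- The label of the parent of the maximum leaf of a tree of size `n`, that is, of the node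
labeled `n`. It is `none` only if that node has no parent (which does not happen in an increasing
tree of size `n ≥ 2`). -/
def pom? (n : ℕ) (t : BinaryTree ℕ) : Option ℕ := parent? n t

/-- The number `f_n(m,k)` of complete increasing trees `t` of size `n` with `eoc(t) = m` and
`pom(t) = k`. -/
noncomputable def f (n m k : ℕ) : ℕ :=
  {t : BinaryTree ℕ | IsCompleteIncreasing n t ∧ eoc t = m ∧ pom? n t = some k}.ncard

/-- The row sum `f_n(m,•)` over all columns `1 ≤ k ≤ n - 1`. -/
noncomputable def rowSum (n m : ℕ) : ℕ := ∑ k ∈ Finset.Icc 1 (n - 1), f n m k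

/-- The column sum `f_n(•,k)` over all rows `2 ≤ m ≤ n`. -/
noncomputable def colSum (n k : ℕ) : ℕ := ∑ m ∈ Finset.Icc 2 n, f n m k

/-- There are finitely many complete increasing trees of size `n`, so that `f` is an honest
count. -/
theorem finite_completeIncreasing (n : ℕ) :
    {t : BinaryTree ℕ | IsCompleteIncreasing n t}.Finite := by
  have key : ∀ h : ℕ, {t : BinaryTree ℕ | t.height ≤ h ∧ ∀ x ∈ labels t, x ≤ n}.Finite := by
    intro h
    induction h with
    | zero =>
      refine (Set.finite_singleton (BinaryTree.nil : BinaryTree ℕ)).subset ?_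
      rintro (_ | ⟨a, l, r⟩) ht
      · rfl
      · simp at ht
    | succ h ih =>
      refine ((Set.finite_singleton (BinaryTree.nil : BinaryTree ℕ)).union
        (((Set.finite_Iic n).prod (ih.prod ih)).image
          (fun p => BinaryTree.node p.1 p.2.1 p.2.2))).subset ?_
      rintro (_ | ⟨a, l, r⟩) ⟨hh, ht⟩
      · exact Or.inl rfl
      · simp only [BinaryTree.height, add_le_add_iff_right, max_le_iff] at hh
        simp only [labels, List.mem_append, List.mem_cons] at ht
        exact Or.inr ⟨(a, l, r), ⟨ht a (Or.inr (Or.inl rfl)),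
          ⟨hh.1, fun x hx => ht x (Or.inl hx)⟩,
          ⟨hh.2, fun x hx => ht x (Or.inr (Or.inr hx))⟩⟩, rfl⟩
  have hlen : ∀ t : BinaryTree ℕ, (labels t).length = t.numNodes := by
    intro t
    induction t with
    | nil => rfl
    | node a l r hl hr => simp only [labels, List.length_append, List.length_cons, hl, hr,
        BinaryTree.numNodes]; omega
  refine (key n).subset ?_
  rintro t ⟨⟨hp, -, -⟩, -⟩
  refine ⟨?_, fun x hx => ?_⟩
  · have := hp.length_eq
    rw [hlen, List.length_range'] at this
    exact this ▸ t.height_le_numNodes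
  · have := hp.mem_iff.1 hx
    rw [List.mem_range'_1] at this
    omega

end SecantTree

namespace SecantTree

/-! Write 2n = M + 2. Everything is counted by bijections between trees of size M + 2 and trees of
size M.

Rows against columns. Delete the root label, move each remaining label of the minimal chain one step
up and put N + 1 at the freed leaf (`slide`). This is a bijection from the secant trees labeled 1,
…, N to those labeled 2, …, N + 1 (`slide_bijOn`): going back, the path to the maximum N + 1 tells
which labels to push down. The former end of the chain is now the parent of N + 1 (`parent?_slide`),
so after lowering all labels by 1, `eoc` = k + 1 corresponds to `pom` = k. Hence row sum k + 1
equals column sum k (`rowSum_succ_eq_colSum`).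

Small `eoc`. If the chain is 1, 2, then 2 is a leaf, necessarily a left one, and the right subtree
is an arbitrary secant tree on 3, …, M + 2 (`leaf_two_bijOn`). If it is 1, 2, 3, removing 2 and the
leaf 3 and joining what remains under a root 3 gives again a secant tree on 3, …, M + 2. It can be
undone in exactly three ways (`exists_split`), and these keep the parent of M + 2 as long as that
parent is at least 4.

Large `pom`. The descendants of the parent k of M + 2 lie in {M + 1, M + 2} once k ≥ M. For k = M +
1 the parent is the rightmost node, with M + 2 as its only child, and cutting it off leaves a secant
tree of size M (`attach_hook_bijOn`). For k = M there is that configuration, whose remainder is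
relabeled to close the gap at M, and there are two more in which M has the children M + 1 and M + 2
in either order; these collapse to a leaf M (`subst_bijOn`). Each of the three classes has the size
of a row sum for M, since none of these operations affects a minimal chain ending below k. -/

/-! ### Basic facts on labels, roots, parents and the end of the minimal chain. -/

theorem rootLabel?_eq_none {t : BinaryTree ℕ} : rootLabel? t = none ↔ t = .nil := by
  cases t <;> simp [rootLabel?]

theorem mem_labels_of_rootLabel? {t : BinaryTree ℕ} {a : ℕ} (h : rootLabel? t = some a) :
    a ∈ labels t := by
  cases t <;> simp_all [rootLabel?, labels]

theorem labels_eq_nil {t : BinaryTree ℕ} : labels t = [] ↔ t = .nil := by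
  cases t <;> simp [labels]

theorem Increasing.le_of_mem {t : BinaryTree ℕ} (ht : Increasing t) {a b : ℕ}
    (ha : rootLabel? t = some a) (hb : b ∈ labels t) : a ≤ b := by
  induction t generalizing a with
  | nil => simp [labels] at hb
  | node c l r hl hr =>
    obtain ⟨h1, h2, h3, h4⟩ := ht
    obtain rfl : c = a := by simpa [rootLabel?] using ha
    rcases List.mem_append.1 hb with hb | hb
    · cases hr' : rootLabel? l with
      | none => simp [rootLabel?_eq_none.1 hr', labels] at hb
      | some d => exact (h1 d hr').le.trans (hl h3 hr' hb)
    · rcases List.mem_cons.1 hb with rfl | hb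
      · exact le_rfl
      · cases hr' : rootLabel? r with
        | none => simp [rootLabel?_eq_none.1 hr', labels] at hb
        | some d => exact (h2 d hr').le.trans (hr h4 hr' hb)

/-- Comparing a node with all its descendants, not only its children, is the form that survives
relabeling and replacement of subtrees. -/
theorem increasing_node {a : ℕ} {l r : BinaryTree ℕ} :
    Increasing (.node a l r) ↔
      (∀ b ∈ labels l, a < b) ∧ (∀ b ∈ labels r, a < b) ∧ Increasing l ∧ Increasing r := by
  have key (t : BinaryTree ℕ) (ht : Increasing t) :
      (∀ b ∈ rootLabel? t, a < b) ↔ ∀ b ∈ labels t, a < b := by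
    refine ⟨fun h b hb => ?_, fun h b hb => h b (mem_labels_of_rootLabel? hb)⟩
    cases hr : rootLabel? t with
    | none => simp [rootLabel?_eq_none.1 hr, labels] at hb
    | some c => exact (h c hr).trans_le (ht.le_of_mem hr hb)
  constructor
  · rintro ⟨h1, h2, h3, h4⟩
    exact ⟨(key l h3).1 h1, (key r h4).1 h2, h3, h4⟩
  · rintro ⟨h1, h2, h3, h4⟩
    exact ⟨(key l h3).2 h1, (key r h4).2 h2, h3, h4⟩

theorem parent?_eq_none {x : ℕ} {t : BinaryTree ℕ} (h : x ∉ labels t) : parent? x t = none := by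
  induction t with
  | nil => rfl
  | node a l r hl hr =>
    simp only [labels, List.mem_append, List.mem_cons, not_or] at h
    have h1 : rootLabel? l ≠ some x := fun e => h.1 (mem_labels_of_rootLabel? e)
    have h2 : rootLabel? r ≠ some x := fun e => h.2.2 (mem_labels_of_rootLabel? e)
    simp [parent?, h1, h2, hl h.1, hr h.2.2]

theorem parent_mem {x k : ℕ} {t : BinaryTree ℕ} (h : parent? x t = some k) :
    k ∈ labels t := by
  induction t with
  | nil => simp [parent?] at h
  | node a l r hl hr =>
    simp only [parent?] at h
    simp only [labels, List.mem_append, List.mem_cons]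
    split_ifs at h with h'
    · exact Or.inr (Or.inl (by simpa using h.symm))
    · rcases Option.or_eq_some_iff.1 h with h | h
      · exact Or.inl (hl h)
      · exact Or.inr (Or.inr (hr h.2))

theorem parent?_isSome {x : ℕ} {t : BinaryTree ℕ} (h : x ∈ labels t)
    (hr : rootLabel? t ≠ some x) : ∃ k, parent? x t = some k := by
  induction t with
  | nil => simp [labels] at h
  | node a l r ihl ihr =>
    simp only [labels, List.mem_append, List.mem_cons] at h
    simp only [rootLabel?, ne_eq, Option.some.injEq] at hr
    simp only [parent?]
    split_ifs with h'
    · exact ⟨a, rfl⟩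
    · push Not at h'
      rcases h with h | h | h
      · obtain ⟨k, hk⟩ := ihl h h'.1
        exact ⟨k, by simp [hk]⟩
      · exact absurd h.symm hr
      · obtain ⟨k, hk⟩ := ihr h h'.2
        cases e : parent? x l <;> simp [hk]

theorem eoc_mem {t : BinaryTree ℕ} (h : t ≠ .nil) : eoc t ∈ labels t := by
  induction t with
  | nil => exact absurd rfl h
  | node a l r hl hr =>
    rcases l with _ | ⟨b, _, _⟩ <;> rcases r with _ | ⟨c, _, _⟩
    · simp [eoc, labels, rootLabel?]
    · have := hr (by simp)
      simp only [eoc, rootLabel?, labels, List.mem_append, List.mem_cons] at this ⊢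
      tauto
    · have := hl (by simp)
      simp only [eoc, rootLabel?, labels, List.mem_append, List.mem_cons] at this ⊢
      tauto
    · have h1 := hl (by simp)
      have h2 := hr (by simp)
      rw [eoc]
      simp only [rootLabel?]
      rw [labels]
      split_ifs
      · exact List.mem_append_left _ h1
      · exact List.mem_append_right _ (List.mem_cons_of_mem _ h2)

/-! ### Sliding along the minimal chain -/

/-- Delete the root label, move every other label of the minimal chain one step towards the root,
and put `x` at the end of the chain. -/
def slide (x : ℕ) : BinaryTree ℕ → BinaryTree ℕ
  | .nil => .nil
  | .node _ l r =>
      match rootLabel? l, rootLabel? r with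
      | none, none => .node x .nil .nil
      | some b, none => .node b (slide x l) r
      | none, some c => .node c l (slide x r)
      | some b, some c => if b < c then .node b (slide x l) r else .node c l (slide x r)

/-- Move every label of the path from the root to `x` one step away from the root, dropping `x` and
putting `y` at the root. -/
def unslide (x : ℕ) : ℕ → BinaryTree ℕ → BinaryTree ℕ
  | _, .nil => .nil
  | y, .node a l r =>
      if x ∈ labels l then .node y (unslide x a l) r
      else if x ∈ labels r then .node y l (unslide x a r)
      else .node y l r

/-- The case distinction along which `slide` and `eoc` recurse. -/
theorem slide_eoc_node (x a : ℕ) (l r : BinaryTree ℕ) :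
    (l = .nil ∧ r = .nil) ∨
    (∃ b, rootLabel? l = some b ∧ (∀ c ∈ rootLabel? r, b < c) ∧
      slide x (.node a l r) = .node b (slide x l) r ∧ eoc (.node a l r) = eoc l) ∨
    (∃ c, rootLabel? r = some c ∧ (∀ b ∈ rootLabel? l, c ≤ b) ∧
      slide x (.node a l r) = .node c l (slide x r) ∧ eoc (.node a l r) = eoc r) := by
  rcases hl : rootLabel? l with _ | b <;> rcases hr : rootLabel? r with _ | c
  · exact Or.inl ⟨rootLabel?_eq_none.1 hl, rootLabel?_eq_none.1 hr⟩
  · exact Or.inr (Or.inr ⟨c, by simp [slide, eoc, hl, hr]⟩)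
  · exact Or.inr (Or.inl ⟨b, by simp [slide, eoc, hl, hr]⟩)
  · by_cases h : b < c
    · exact Or.inr (Or.inl ⟨b, by simp [slide, eoc, hl, hr, h]⟩)
    · exact Or.inr (Or.inr ⟨c, by simp [slide, eoc, hl, hr, h]; omega⟩)

theorem slide_eq_node_left {x a b : ℕ} {l r : BinaryTree ℕ} (hl : rootLabel? l = some b)
    (hr : ∀ c ∈ rootLabel? r, b < c) : slide x (.node a l r) = .node b (slide x l) r := by
  rcases hr' : rootLabel? r with _ | c
  · simp [slide, hl, hr']
  · simp [slide, hl, hr', hr c hr']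

theorem slide_eq_node_right {x a c : ℕ} {l r : BinaryTree ℕ} (hr : rootLabel? r = some c)
    (hl : ∀ b ∈ rootLabel? l, c < b) : slide x (.node a l r) = .node c l (slide x r) := by
  rcases hl' : rootLabel? l with _ | b
  · simp [slide, hr, hl']
  · simp [slide, hr, hl', (hl b hl').le]

theorem slide_leaf (x a : ℕ) : slide x (.node a .nil .nil) = .node x .nil .nil := by
  simp [slide, rootLabel?]

theorem eoc_leaf (a : ℕ) : eoc (.node a .nil .nil) = a := by
  simp [eoc, rootLabel?]

theorem slide_eq_nil {x : ℕ} {t : BinaryTree ℕ} : slide x t = .nil ↔ t = .nil := by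
  rcases t with _ | ⟨a, l, r⟩
  · simp [slide]
  · rcases slide_eoc_node x a l r with ⟨rfl, rfl⟩ | ⟨b, -, -, h, -⟩ | ⟨c, -, -, h, -⟩
    · simp [slide_leaf]
    · simp [h]
    · simp [h]

/-- Sliding trades the root label for `x`; adding the lost label on the other side avoids removing
an element from a list. -/
theorem cons_labels_slide (x : ℕ) {t : BinaryTree ℕ} {a : ℕ} (ha : rootLabel? t = some a) :
    (a :: labels (slide x t)).Perm (x :: labels t) := by
  induction t generalizing a with
  | nil => simp [rootLabel?] at ha
  | node a' l r ihl ihr =>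
    obtain rfl : a' = a := by simpa [rootLabel?] using ha
    rcases slide_eoc_node x a' l r with ⟨rfl, rfl⟩ | ⟨b, hb, -, h, -⟩ | ⟨c, hc, -, h, -⟩
    · simpa [slide_leaf, labels] using List.Perm.swap _ _ _
    · rw [h]
      have := ihl hb
      simp only [← Multiset.coe_eq_coe, labels, ← Multiset.cons_coe, ← Multiset.coe_add] at this ⊢
      rw [← Multiset.singleton_add] at this ⊢
      simp only [← Multiset.singleton_add] at this ⊢
      rw [show ({x} + (↑(labels l) + ({a'} + ↑(labels r))) : Multiset ℕ)
        = {x} + ↑(labels l) + ({a'} + ↑(labels r)) by abel, ← this]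
      abel
    · rw [h]
      have := ihr hc
      simp only [← Multiset.coe_eq_coe, labels, ← Multiset.cons_coe, ← Multiset.coe_add] at this ⊢
      simp only [← Multiset.singleton_add] at this ⊢
      rw [show ({x} + (↑(labels l) + ({a'} + ↑(labels r))) : Multiset ℕ)
        = ({x} + ↑(labels r)) + (↑(labels l) + {a'}) by abel, ← this]
      abel

theorem mem_labels_slide {x y : ℕ} {t : BinaryTree ℕ} (h : y ∈ labels (slide x t)) :
    y = x ∨ y ∈ labels t := by
  rcases ht : rootLabel? t with _ | a
  · simp [rootLabel?_eq_none.1 ht, slide, labels] at h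
  · simpa using (cons_labels_slide x ht).mem_iff.1 (List.mem_cons_of_mem a h)

theorem mem_labels_slide_self {x : ℕ} {t : BinaryTree ℕ} (h : t ≠ .nil) (hx : x ∉ labels t) :
    x ∈ labels (slide x t) := by
  rcases ht : rootLabel? t with _ | a
  · exact absurd (rootLabel?_eq_none.1 ht) h
  · have := (cons_labels_slide x ht).mem_iff.2 List.mem_cons_self
    rcases List.mem_cons.1 this with rfl | h
    · exact absurd (mem_labels_of_rootLabel? ht) hx
    · exact h

theorem lt_of_mem_labels_slide {x a y : ℕ} {t : BinaryTree ℕ} (ht : Increasing t)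
    (hn : (labels t).Nodup) (hx : ∀ z ∈ labels t, z < x) (ha : rootLabel? t = some a)
    (hy : y ∈ labels (slide x t)) : a < y := by
  have hax := hx a (mem_labels_of_rootLabel? ha)
  have hp := cons_labels_slide x ha
  have hnd : (a :: labels (slide x t)).Nodup :=
    hp.nodup_iff.2 (List.nodup_cons.2 ⟨fun h => (hx x h).false, hn⟩)
  have hne : a ≠ y := by rintro rfl; exact (List.nodup_cons.1 hnd).1 hy
  rcases mem_labels_slide hy with rfl | h
  · exact hax
  · exact lt_of_le_of_ne (ht.le_of_mem ha h) hne

theorem nodup_node {a : ℕ} {l r : BinaryTree ℕ} (h : (labels (.node a l r)).Nodup) :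
    (labels l).Nodup ∧ (labels r).Nodup ∧ a ∉ labels l ∧ a ∉ labels r ∧
      ∀ x ∈ labels l, x ∉ labels r := by
  simp only [labels, List.nodup_append, List.nodup_cons] at h
  obtain ⟨h1, ⟨h2, h3⟩, h4⟩ := h
  exact ⟨h1, h3, fun ha => h4 a ha a (by simp) rfl, h2,
    fun x hx hx' => h4 x hx x (by simp [hx']) rfl⟩

/-- The label that moves up is the smaller child, so it stays below its former sibling, and it is
below whatever replaces it. -/
theorem increasing_slide {x : ℕ} {t : BinaryTree ℕ} (ht : Increasing t) (hn : (labels t).Nodup)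
    (hx : ∀ z ∈ labels t, z < x) : Increasing (slide x t) := by
  induction t with
  | nil => trivial
  | node a l r ihl ihr =>
    obtain ⟨nl, nr, al, ar, hd⟩ := nodup_node hn
    obtain ⟨h1, h2, h3, h4⟩ := increasing_node.1 ht
    simp only [labels, List.mem_append, List.mem_cons] at hx
    have hxl : ∀ z ∈ labels l, z < x := fun z hz => hx z (Or.inl hz)
    have hxr : ∀ z ∈ labels r, z < x := fun z hz => hx z (Or.inr (Or.inr hz))
    rcases slide_eoc_node x a l r with ⟨rfl, rfl⟩ | ⟨b, hb, hbr, h, -⟩ | ⟨c, hc, hcl, h, -⟩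
    · simp [slide_leaf, Increasing, rootLabel?]
    · rw [h, increasing_node]
      refine ⟨fun y hy => lt_of_mem_labels_slide h3 nl hxl hb hy, fun y hy => ?_, ihl h3 nl hxl, h4⟩
      rcases hr : rootLabel? r with _ | c
      · simp [rootLabel?_eq_none.1 hr, labels] at hy
      · exact (hbr c hr).trans_le (h4.le_of_mem hr hy)
    · rw [h, increasing_node]
      refine ⟨fun y hy => ?_, fun y hy => lt_of_mem_labels_slide h4 nr hxr hc hy, h3, ihr h4 nr hxr⟩
      rcases hl : rootLabel? l with _ | b
      · simp [rootLabel?_eq_none.1 hl, labels] at hy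
      -- The tie rule of the chain only gives `c ≤ b`; distinctness of the labels makes it strict.
      · have : c ≠ b := by
          rintro rfl
          exact hd c (mem_labels_of_rootLabel? hl) (mem_labels_of_rootLabel? hc)
        exact (lt_of_le_of_ne (hcl b hl) this).trans_le (h3.le_of_mem hl hy)

theorem everyNodeFull_slide {x : ℕ} {t : BinaryTree ℕ} :
    EveryNodeFull (slide x t) ↔ EveryNodeFull t := by
  induction t with
  | nil => simp [slide]
  | node a l r ihl ihr =>
    rcases slide_eoc_node x a l r with ⟨rfl, rfl⟩ | ⟨b, hb, hbr, h, -⟩ | ⟨c, hc, hcl, h, -⟩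
    · simp [slide_leaf, EveryNodeFull]
    · simp [h, EveryNodeFull, ihl, slide_eq_nil]
    · simp [h, EveryNodeFull, ihr, slide_eq_nil]

theorem fullExceptRightmost_slide {x : ℕ} {t : BinaryTree ℕ} :
    FullExceptRightmost (slide x t) ↔ FullExceptRightmost t := by
  induction t with
  | nil => simp [slide]
  | node a l r ihl ihr =>
    rcases slide_eoc_node x a l r with ⟨rfl, rfl⟩ | ⟨b, hb, hbr, h, -⟩ | ⟨c, hc, hcl, h, -⟩
    · simp [slide_leaf, FullExceptRightmost]
    · simp [h, FullExceptRightmost, everyNodeFull_slide, slide_eq_nil]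
    · simp [h, FullExceptRightmost, ihr, slide_eq_nil]

/-- Since `x` is fresh, its position after the slide marks the path along which labels were moved.
-/
theorem unslide_slide {x a : ℕ} {t : BinaryTree ℕ} (ha : rootLabel? t = some a)
    (hx : x ∉ labels t) : unslide x a (slide x t) = t := by
  induction t generalizing a with
  | nil => rfl
  | node a' l r ihl ihr =>
    obtain rfl : a' = a := by simpa [rootLabel?] using ha
    simp only [labels, List.mem_append, List.mem_cons, not_or] at hx
    have hne {t : BinaryTree ℕ} {b : ℕ} (h : rootLabel? t = some b) : t ≠ .nil := by
      rintro rfl; simp [rootLabel?] at h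
    rcases slide_eoc_node x a' l r with ⟨rfl, rfl⟩ | ⟨b, hb, hbr, h, -⟩ | ⟨c, hc, hcl, h, -⟩
    · simp [slide_leaf, unslide, labels]
    · rw [h, unslide, if_pos (mem_labels_slide_self (hne hb) hx.1), ihl hb hx.1]
    · rw [h, unslide, if_neg hx.1, if_pos (mem_labels_slide_self (hne hc) hx.2.2), ihr hc hx.2.2]

theorem rootLabel?_unslide {x y : ℕ} {t : BinaryTree ℕ} (h : t ≠ .nil) :
    rootLabel? (unslide x y t) = some y := by
  cases t with
  | nil => exact absurd rfl h
  | node a l r =>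
    rw [unslide]
    split_ifs <;> rfl

theorem ne_nil_of_mem {x : ℕ} {t : BinaryTree ℕ} (h : x ∈ labels t) : t ≠ .nil := by
  rintro rfl; simp [labels] at h

theorem children_eq_nil {a : ℕ} {l r : BinaryTree ℕ} (ht : Increasing (.node a l r))
    (hmax : ∀ z ∈ labels (.node a l r), z ≤ a) : l = .nil ∧ r = .nil := by
  obtain ⟨h1, h2, -, -⟩ := increasing_node.1 ht
  simp only [labels, List.mem_append, List.mem_cons] at hmax
  constructor <;> rw [← labels_eq_nil, List.eq_nil_iff_forall_not_mem] <;> intro b hb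
  · exact absurd (hmax b (Or.inl hb)) (not_le.2 (h1 b hb))
  · exact absurd (hmax b (Or.inr (Or.inr hb))) (not_le.2 (h2 b hb))

/-- After unsliding, a node on the path to `x` carries the label of its former parent, which is
smaller than everything in the sibling subtree. So that path is the minimal chain, and it ends at a
leaf because `x` is maximal. -/
theorem slide_unslide {x y : ℕ} {t : BinaryTree ℕ} (ht : Increasing t) (hx : x ∈ labels t)
    (hmax : ∀ z ∈ labels t, z ≤ x) : slide x (unslide x y t) = t := by
  induction t generalizing y with
  | nil => rfl
  | node a l r ihl ihr =>
    have hmax' := hmax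
    obtain ⟨h1, h2, h3, h4⟩ := increasing_node.1 ht
    simp only [labels, List.mem_append, List.mem_cons] at hmax hx
    have hxl : ∀ z ∈ labels l, z ≤ x := fun z hz => hmax z (Or.inl hz)
    have hxr : ∀ z ∈ labels r, z ≤ x := fun z hz => hmax z (Or.inr (Or.inr hz))
    rw [unslide]
    split_ifs with hl hr
    · rw [slide_eq_node_left (rootLabel?_unslide (ne_nil_of_mem hl))
        (fun c hc => h2 c (mem_labels_of_rootLabel? hc)), ihl h3 hl hxl]
    · rw [slide_eq_node_right (rootLabel?_unslide (ne_nil_of_mem hr))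
        (fun c hc => h1 c (mem_labels_of_rootLabel? hc)), ihr h4 hr hxr]
    · obtain rfl : x = a := by tauto
      obtain ⟨rfl, rfl⟩ := children_eq_nil ht hmax'
      rw [slide_leaf]

theorem mem_labels_unslide {x y z : ℕ} {t : BinaryTree ℕ} (h : z ∈ labels (unslide x y t)) :
    z = y ∨ z ∈ labels t := by
  induction t generalizing y with
  | nil => simp [unslide, labels] at h
  | node a l r ihl ihr =>
    rw [unslide] at h
    simp only [labels, List.mem_append, List.mem_cons]
    split_ifs at h <;> simp only [labels, List.mem_append, List.mem_cons] at h
    · rcases h with h | h | h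
      · have := ihl h; tauto
      · tauto
      · tauto
    · rcases h with h | h | h
      · tauto
      · tauto
      · have := ihr h; tauto
    · tauto

theorem increasing_unslide {x y : ℕ} {t : BinaryTree ℕ} (ht : Increasing t)
    (hy : ∀ z ∈ labels t, y < z) : Increasing (unslide x y t) := by
  induction t generalizing y with
  | nil => trivial
  | node a l r ihl ihr =>
    obtain ⟨h1, h2, h3, h4⟩ := increasing_node.1 ht
    simp only [labels, List.mem_append, List.mem_cons] at hy
    have hya := hy a (by simp)
    rw [unslide]
    split_ifs <;> rw [increasing_node]
    · refine ⟨fun z hz => ?_, fun z hz => hya.trans (h2 z hz), ihl h3 h1, h4⟩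
      rcases mem_labels_unslide hz with rfl | hz
      · exact hya
      · exact hya.trans (h1 z hz)
    · refine ⟨fun z hz => hya.trans (h1 z hz), fun z hz => ?_, h3, ihr h4 h2⟩
      rcases mem_labels_unslide hz with rfl | hz
      · exact hya
      · exact hya.trans (h2 z hz)
    · exact ⟨fun z hz => hya.trans (h1 z hz), fun z hz => hya.trans (h2 z hz), h3, h4⟩

theorem rootLabel?_slide_ne {x a : ℕ} {l r : BinaryTree ℕ} (h : ¬(l = .nil ∧ r = .nil))
    (hx : x ∉ labels (.node a l r)) : rootLabel? (slide x (.node a l r)) ≠ some x := by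
  simp only [labels, List.mem_append, List.mem_cons, not_or] at hx
  rcases slide_eoc_node x a l r with h' | ⟨b, hb, hbr, h', -⟩ | ⟨c, hc, hcl, h', -⟩
  · exact absurd h' h
  · rw [h', rootLabel?]
    rintro ⟨⟩
    exact hx.1 (mem_labels_of_rootLabel? hb)
  · rw [h', rootLabel?]
    rintro ⟨⟩
    exact hx.2.2 (mem_labels_of_rootLabel? hc)

theorem parent?_slide {x a : ℕ} {l r : BinaryTree ℕ} (h : ¬(l = .nil ∧ r = .nil))
    (hx : x ∉ labels (.node a l r)) :
    parent? x (slide x (.node a l r)) = some (eoc (.node a l r)) := by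
  -- When the chain inside `t` is a single leaf, `x` becomes the root and has no parent within `t`.
  -- The label `b` then moves to the node above, so the first alternative lets the induction read
  -- off the parent there.
  have key : ∀ t : BinaryTree ℕ, ∀ b, x ∉ labels t → rootLabel? t = some b →
      (rootLabel? (slide x t) = some x ∧ b = eoc t) ∨
      (rootLabel? (slide x t) ≠ some x ∧ parent? x (slide x t) = some (eoc t)) := by
    intro t
    induction t with
    | nil => simp [rootLabel?]
    | node a l r ihl ihr =>
      rintro b hx hb
      obtain rfl : a = b := by simpa [rootLabel?] using hb
      by_cases hlr : l = .nil ∧ r = .nil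
      · obtain ⟨rfl, rfl⟩ := hlr
        simp [slide_leaf, eoc_leaf, rootLabel?]
      · refine Or.inr ⟨rootLabel?_slide_ne hlr hx, ?_⟩
        simp only [labels, List.mem_append, List.mem_cons, not_or] at hx
        have hl : rootLabel? l ≠ some x := fun e => hx.1 (mem_labels_of_rootLabel? e)
        have hr : rootLabel? r ≠ some x := fun e => hx.2.2 (mem_labels_of_rootLabel? e)
        rcases slide_eoc_node x a l r with h' | ⟨b, hb, hbr, h', h''⟩ | ⟨c, hc, hcl, h', h''⟩
        · exact absurd h' hlr
        · rw [h', h'', parent?]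
          rcases ihl b hx.1 hb with ⟨e1, e2⟩ | ⟨e1, e2⟩
          · simp [e1, e2]
          · simp [e1, hr, e2]
        · rw [h', h'', parent?]
          rcases ihr c hx.2.2 hc with ⟨e1, e2⟩ | ⟨e1, e2⟩
          · simp [e1, e2]
          · simp [e1, hl, e2, parent?_eq_none hx.1]
  rcases key _ a hx rfl with h' | h'
  · exact absurd h'.1 (rootLabel?_slide_ne h hx)
  · exact h'.2

/-! ### Secant trees on an interval of labels, and the counts as cardinalities. -/

/-- The complete increasing trees of even size `N`, labeled `c, c + 1, …, c + N - 1`. -/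
def secantTrees (c N : ℕ) : Set (BinaryTree ℕ) :=
  {t | (labels t).Perm (List.range' c N) ∧ Increasing t ∧ FullExceptRightmost t}

theorem mem_labels_iff {c N : ℕ} {t : BinaryTree ℕ} (h : (labels t).Perm (List.range' c N)) {x : ℕ} :
    x ∈ labels t ↔ c ≤ x ∧ x < c + N := by
  rw [h.mem_iff, List.mem_range'_1]

theorem nodup_labels {c N : ℕ} {t : BinaryTree ℕ} (h : (labels t).Perm (List.range' c N)) :
    (labels t).Nodup :=
  h.nodup_iff.2 List.nodup_range'

theorem FullExceptRightmost.ne_nil {t : BinaryTree ℕ} (h : FullExceptRightmost t) : t ≠ .nil := by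
  rintro rfl; exact h

theorem rootLabel?_eq {c N : ℕ} {t : BinaryTree ℕ} (h : (labels t).Perm (List.range' c N))
    (ht : Increasing t) (hn : t ≠ .nil) : rootLabel? t = some c := by
  rcases ha : rootLabel? t with _ | a
  · exact absurd (rootLabel?_eq_none.1 ha) hn
  · have h1 := (mem_labels_iff h).1 (mem_labels_of_rootLabel? ha)
    have h2 := ht.le_of_mem ha ((mem_labels_iff h (x := c)).2 ⟨le_rfl, by omega⟩)
    rw [show a = c by omega]

theorem isCompleteIncreasing_iff {N : ℕ} (hN : Even N) {t : BinaryTree ℕ} :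
    IsCompleteIncreasing N t ↔ t ∈ secantTrees 1 N := by
  simp only [IsCompleteIncreasing, IsIncreasingTree, hN, if_true, secantTrees, Set.mem_ofPred_eq]
  constructor
  · rintro ⟨⟨h1, -, h2⟩, h3⟩
    exact ⟨h1, h2, h3⟩
  · rintro ⟨h1, h2, h3⟩
    exact ⟨⟨h1, rootLabel?_eq h1 h2 h3.ne_nil, h2⟩, h3⟩

theorem finite_secantTrees {N : ℕ} (hN : Even N) : (secantTrees 1 N).Finite :=
  (finite_completeIncreasing N).subset fun _ ht => (isCompleteIncreasing_iff hN).2 ht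

theorem f_eq {N : ℕ} (hN : Even N) (m k : ℕ) :
    f N m k = {t ∈ secantTrees 1 N | eoc t = m ∧ parent? N t = some k}.ncard := by
  simp only [f, isCompleteIncreasing_iff hN, pom?]

/-- The injection `e` is `some` for the optional parent label and the identity for `eoc` and for
subtrees. -/
theorem sum_ncard_fiber {α β ι : Type*} {S : Set α} (hS : S.Finite) (I : Finset ι) (g : α → β)
    {e : ι → β} (he : e.Injective) (hg : ∀ t ∈ S, ∃ i ∈ I, g t = e i) :
    ∑ i ∈ I, {t ∈ S | g t = e i}.ncard = S.ncard := by
  classical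
  have hfin : ∀ i, {t ∈ S | g t = e i}.Finite := fun i => hS.subset fun _ h => h.1
  simp_rw [fun i => Set.ncard_eq_toFinset_card _ (hfin i)]
  rw [← Finset.card_biUnion, Set.ncard_eq_toFinset_card _ hS]
  · congr 1
    ext t
    simp only [Finset.mem_biUnion, Set.Finite.mem_toFinset, Set.mem_ofPred_eq]
    refine ⟨fun ⟨_, _, h, _⟩ => h, fun h => ?_⟩
    obtain ⟨i, hi, hgi⟩ := hg t h
    exact ⟨i, hi, h, hgi⟩
  · intro i _ j _ hij
    simp only [Finset.disjoint_left, Set.Finite.mem_toFinset, Set.mem_ofPred_eq]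
    rintro t ⟨-, h1⟩ ⟨-, h2⟩
    exact hij (he (h1.symm.trans h2))

theorem lt_eoc {a : ℕ} {l r : BinaryTree ℕ} (ht : Increasing (.node a l r))
    (h : ¬(l = .nil ∧ r = .nil)) : a < eoc (.node a l r) := by
  obtain ⟨h1, h2, -, -⟩ := increasing_node.1 ht
  rcases slide_eoc_node 0 a l r with h' | ⟨b, hb, -, -, h''⟩ | ⟨c, hc, -, -, h''⟩
  · exact absurd h' h
  · rw [h'']
    exact h1 _ (eoc_mem (ne_nil_of_mem (mem_labels_of_rootLabel? hb)))
  · rw [h'']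
    exact h2 _ (eoc_mem (ne_nil_of_mem (mem_labels_of_rootLabel? hc)))

theorem two_le_of_mem_secantTrees {c N : ℕ} {t : BinaryTree ℕ} (ht : t ∈ secantTrees c N) :
    2 ≤ N := by
  obtain ⟨h1, -, h3⟩ := ht
  rcases t with _ | ⟨a, l, r⟩
  · exact h3.elim
  · have hl := h3.1
    have := h1.length_eq
    rw [ne_eq, ← labels_eq_nil, ← ne_eq, ← List.length_pos_iff] at hl
    simp only [labels, List.length_append, List.length_cons, List.length_range'] at this
    omega

/-- With `exists_parent`, this shows that the summation ranges of `colSum` and `rowSum` miss no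
tree. -/
theorem eoc_mem_Icc {N : ℕ} {t : BinaryTree ℕ} (ht : t ∈ secantTrees 1 N) :
    eoc t ∈ Finset.Icc 2 N := by
  obtain ⟨h1, h2, h3⟩ := ht
  have hroot := rootLabel?_eq h1 h2 h3.ne_nil
  rcases t with _ | ⟨a, l, r⟩
  · exact h3.elim
  · obtain rfl : a = 1 := by simpa [rootLabel?] using hroot
    have := lt_eoc h2 fun h => h3.1 h.1
    have := (mem_labels_iff h1).1 (eoc_mem h3.ne_nil)
    rw [Finset.mem_Icc]
    omega

theorem parent?_lt {x k : ℕ} {t : BinaryTree ℕ} (ht : Increasing t) (h : parent? x t = some k) :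
    k < x := by
  induction t with
  | nil => simp [parent?] at h
  | node a l r hl hr =>
    obtain ⟨h1, h2, h3, h4⟩ := increasing_node.1 ht
    simp only [parent?] at h
    split_ifs at h with h'
    · obtain rfl : a = k := by simpa using h
      rcases h' with h' | h'
      · exact h1 _ (mem_labels_of_rootLabel? h')
      · exact h2 _ (mem_labels_of_rootLabel? h')
    · rcases Option.or_eq_some_iff.1 h with h | h
      · exact hl h3 h
      · exact hr h4 h.2

theorem exists_parent {N : ℕ} {t : BinaryTree ℕ} (ht : t ∈ secantTrees 1 N) :
    ∃ k ∈ Finset.Icc 1 (N - 1), parent? N t = some k := by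
  have hN := two_le_of_mem_secantTrees ht
  obtain ⟨h1, h2, h3⟩ := ht
  have hroot := rootLabel?_eq h1 h2 h3.ne_nil
  obtain ⟨k, hk⟩ := parent?_isSome ((mem_labels_iff h1 (x := N)).2 ⟨by omega, by omega⟩)
    (by rw [hroot]; intro h; injection h; omega)
  have := parent?_lt h2 hk
  have := (mem_labels_iff h1).1 (parent_mem hk)
  exact ⟨k, by rw [Finset.mem_Icc]; omega, hk⟩

theorem rowSum_eq {N : ℕ} (hN : Even N) (m : ℕ) :
    rowSum N m = {t ∈ secantTrees 1 N | eoc t = m}.ncard := by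
  rw [← sum_ncard_fiber ((finite_secantTrees hN).subset fun _ h => h.1) (Finset.Icc 1 (N - 1))
    (parent? N) (Option.some_injective ℕ) fun t ht => exists_parent ht.1]
  refine Finset.sum_congr rfl fun k _ => ?_
  rw [f_eq hN]
  simp only [Set.mem_ofPred_eq, and_assoc]

theorem colSum_eq {N : ℕ} (hN : Even N) (k : ℕ) :
    colSum N k = {t ∈ secantTrees 1 N | parent? N t = some k}.ncard := by
  rw [← sum_ncard_fiber ((finite_secantTrees hN).subset fun _ h => h.1) (Finset.Icc 2 N)
    eoc Function.injective_id fun t ht => ⟨_, eoc_mem_Icc ht.1, rfl⟩]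
  refine Finset.sum_congr rfl fun m _ => ?_
  rw [f_eq hN]
  simp only [Set.mem_ofPred_eq, and_assoc, id, and_comm (a := eoc _ = m)]

/-! ### Translating the labels -/

theorem labels_map (g : ℕ → ℕ) (t : BinaryTree ℕ) : labels (t.map g) = (labels t).map g := by
  induction t with
  | nil => rfl
  | node a l r hl hr => simp [BinaryTree.map, labels, hl, hr]

theorem rootLabel?_map (g : ℕ → ℕ) (t : BinaryTree ℕ) :
    rootLabel? (t.map g) = (rootLabel? t).map g := by
  cases t <;> rfl

theorem map_eq_nil {g : ℕ → ℕ} {t : BinaryTree ℕ} : t.map g = .nil ↔ t = .nil := by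
  cases t <;> simp [BinaryTree.map]

theorem everyNodeFull_map {g : ℕ → ℕ} {t : BinaryTree ℕ} :
    EveryNodeFull (t.map g) ↔ EveryNodeFull t := by
  induction t with
  | nil => rfl
  | node a l r hl hr => simp [BinaryTree.map, EveryNodeFull, map_eq_nil, hl, hr]

theorem fullExceptRightmost_map {g : ℕ → ℕ} {t : BinaryTree ℕ} :
    FullExceptRightmost (t.map g) ↔ FullExceptRightmost t := by
  induction t with
  | nil => rfl
  | node a l r hl hr =>
    simp [BinaryTree.map, FullExceptRightmost, map_eq_nil, everyNodeFull_map, hr]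

theorem increasing_map {g : ℕ → ℕ} (hg : StrictMono g) {t : BinaryTree ℕ} :
    Increasing (t.map g) ↔ Increasing t := by
  induction t with
  | nil => rfl
  | node a l r hl hr =>
    simp [BinaryTree.map, increasing_node, labels_map, hl, hr, hg.lt_iff_lt]

theorem parent?_map {g : ℕ → ℕ} (hg : g.Injective) (x : ℕ) (t : BinaryTree ℕ) :
    parent? (g x) (t.map g) = (parent? x t).map g := by
  induction t with
  | nil => rfl
  | node a l r hl hr =>
    have key (t : BinaryTree ℕ) : rootLabel? (t.map g) = some (g x) ↔ rootLabel? t = some x := by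
      cases t <;> simp [BinaryTree.map, rootLabel?, hg.eq_iff]
    simp only [BinaryTree.map, parent?, hl, hr, key]
    split_ifs
    · rfl
    · cases parent? x l <;> simp

theorem map_injective {g : ℕ → ℕ} (hg : g.Injective) :
    Function.Injective (BinaryTree.map g) := by
  intro t t' h
  induction t generalizing t' with
  | nil => exact (map_eq_nil.1 h.symm).symm
  | node a l r hl hr =>
    cases t' with
    | nil => simp [BinaryTree.map] at h
    | node a' l' r' =>
      simp only [BinaryTree.map, BinaryTree.node.injEq] at h
      rw [hg h.1, hl h.2.1, hr h.2.2]

theorem exists_map_eq {g : ℕ → ℕ} {t : BinaryTree ℕ} (h : ∀ x ∈ labels t, ∃ y, g y = x) :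
    ∃ t', BinaryTree.map g t' = t := by
  induction t with
  | nil => exact ⟨.nil, rfl⟩
  | node a l r hl hr =>
    simp only [labels, List.mem_append, List.mem_cons] at h
    obtain ⟨b, rfl⟩ := h a (by simp)
    obtain ⟨l', rfl⟩ := hl fun x hx => h x (Or.inl hx)
    obtain ⟨r', rfl⟩ := hr fun x hx => h x (Or.inr (Or.inr hx))
    exact ⟨.node b l' r', rfl⟩

/-- The label list is arbitrary so that the same statement covers translations and the relabeling
that skips one label. -/
theorem map_bijOn {g : ℕ → ℕ} (hg : StrictMono g) (L : List ℕ) :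
    Set.BijOn (BinaryTree.map g)
      {t | (labels t).Perm L ∧ Increasing t ∧ FullExceptRightmost t}
      {t | (labels t).Perm (L.map g) ∧ Increasing t ∧ FullExceptRightmost t} := by
  have hiff : ∀ t, BinaryTree.map g t ∈
      {t | (labels t).Perm (L.map g) ∧ Increasing t ∧ FullExceptRightmost t} ↔
      t ∈ {t | (labels t).Perm L ∧ Increasing t ∧ FullExceptRightmost t} := by
    intro t
    simp only [Set.mem_ofPred_eq, labels_map, increasing_map hg,
      fullExceptRightmost_map, List.map_perm_map_iff hg.injective]
  refine ⟨fun t ht => (hiff t).2 ht, (map_injective hg.injective).injOn, fun t ht => ?_⟩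
  obtain ⟨t', rfl⟩ := exists_map_eq (g := g) (t := t) fun x hx => by
    obtain ⟨y, -, hy⟩ := List.mem_map.1 (ht.1.mem_iff.1 hx)
    exact ⟨y, hy⟩
  exact ⟨t', (hiff t').1 ht, rfl⟩

theorem map_add_bijOn (c d N : ℕ) :
    Set.BijOn (BinaryTree.map (· + d)) (secantTrees c N) (secantTrees (c + d) N) := by
  have hrange : List.range' (c + d) N = (List.range' c N).map (· + d) := by
    rw [add_comm c d, ← List.map_add_range' (a := d) c N 1]
    simp only [add_comm d]
  rw [secantTrees, secantTrees, hrange]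
  exact map_bijOn (fun a b h => Nat.add_lt_add_right h d) _

/-! ### Equidistribution of `eoc` and `1 + pom` -/

theorem slide_bijOn (N : ℕ) :
    Set.BijOn (slide (N + 1)) (secantTrees 1 N) (secantTrees 2 N) := by
  have hcons : (1 :: List.range' 2 N).Perm ((N + 1) :: List.range' 1 N) := by
    have h : 1 :: List.range' 2 N = List.range' 1 N ++ [N + 1] := by
      rw [← List.range'_succ (s := 1) (step := 1), List.range'_concat]
      simp [add_comm]
    rw [h]
    exact List.perm_append_singleton _ _
  refine Set.InvOn.bijOn (f' := unslide (N + 1) 1) ⟨fun t ht => ?_, fun t ht => ?_⟩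
    (fun t ht => ?_) (fun t ht => ?_)
  · obtain ⟨h1, h2, h3⟩ := ht
    exact unslide_slide (rootLabel?_eq h1 h2 h3.ne_nil) fun h => by
      have := (mem_labels_iff h1).1 h; omega
  · have hN := two_le_of_mem_secantTrees ht
    obtain ⟨h1, h2, h3⟩ := ht
    exact slide_unslide h2 ((mem_labels_iff h1).2 (by omega)) fun z hz => by
      have := (mem_labels_iff h1).1 hz; omega
  · obtain ⟨h1, h2, h3⟩ := ht
    refine ⟨?_, increasing_slide h2 (nodup_labels h1) fun z hz => ?_,
      fullExceptRightmost_slide.2 h3⟩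
    · exact List.Perm.cons_inv ((cons_labels_slide (N + 1) (rootLabel?_eq h1 h2 h3.ne_nil)).trans
        ((h1.cons _).trans hcons.symm))
    · have := (mem_labels_iff h1).1 hz; omega
  · have hN := two_le_of_mem_secantTrees ht
    obtain ⟨h1, h2, h3⟩ := ht
    have hs : slide (N + 1) (unslide (N + 1) 1 t) = t :=
      slide_unslide h2 ((mem_labels_iff h1).2 (by omega)) fun z hz => by
        have := (mem_labels_iff h1).1 hz; omega
    refine ⟨?_, increasing_unslide h2 fun z hz => ?_, ?_⟩
    -- The labels of the unslid tree are deduced from those of its slide, which is `t`; the shape is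
    -- handled the same way below.
    · have := cons_labels_slide (N + 1) (rootLabel?_unslide (x := N + 1) (y := 1) h3.ne_nil)
      rw [hs] at this
      exact List.Perm.cons_inv (this.symm.trans ((h1.cons _).trans hcons))
    · have := (mem_labels_iff h1).1 hz; omega
    · rw [← fullExceptRightmost_slide (x := N + 1), hs]
      exact h3

theorem bijOn_sep {α β : Type*} {g : α → β} {s : Set α} {t : Set β} (h : Set.BijOn g s t)
    {p : α → Prop} {q : β → Prop} (hpq : ∀ a ∈ s, (q (g a) ↔ p a)) :
    Set.BijOn g {a ∈ s | p a} {b ∈ t | q b} := by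
  refine ⟨fun a ha => ⟨h.mapsTo ha.1, (hpq a ha.1).2 ha.2⟩, h.injOn.mono fun _ ha => ha.1, ?_⟩
  rintro b ⟨hb, hq⟩
  obtain ⟨a, ha, rfl⟩ := h.surjOn hb
  exact ⟨a, ⟨ha, (hpq a ha).1 hq⟩, rfl⟩

/-- The labels `eoc` and `1 + pom` are equidistributed on the secant trees of a given size. -/
theorem ncard_eoc_eq_ncard_parent (N k : ℕ) :
    {t ∈ secantTrees 1 N | eoc t = k + 1}.ncard =
      {t ∈ secantTrees 1 N | parent? N t = some k}.ncard := by
  have h1 : Set.BijOn (slide (N + 1)) {t ∈ secantTrees 1 N | eoc t = k + 1}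
      {t ∈ secantTrees 2 N | parent? (N + 1) t = some (k + 1)} := by
    refine bijOn_sep (slide_bijOn N) fun t ht => ?_
    obtain ⟨h1, h2, h3⟩ := ht
    rcases t with _ | ⟨a, l, r⟩
    · exact h3.elim
    · rw [parent?_slide (fun h => h3.1 h.1) fun h => by
        have := (mem_labels_iff h1).1 h; omega]
      simp
  have h2 : Set.BijOn (BinaryTree.map (· + 1)) {t ∈ secantTrees 1 N | parent? N t = some k}
      {t ∈ secantTrees 2 N | parent? (N + 1) t = some (k + 1)} := by
    refine bijOn_sep (map_add_bijOn 1 1 N) fun t ht => ?_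
    rw [parent?_map (g := (· + 1)) (add_left_injective 1) N t]
    cases parent? N t <;> simp
  rw [h1.ncard_eq, h2.ncard_eq]

/-! ### Short minimal chains and the two subtrees of the root. -/

@[simp] theorem rootLabel?_nil : rootLabel? .nil = none := rfl

@[simp] theorem rootLabel?_node (a : ℕ) (l r : BinaryTree ℕ) :
    rootLabel? (.node a l r) = some a := rfl

@[simp] theorem increasing_nil : Increasing .nil := trivial

theorem range'_one_add_two (M : ℕ) : List.range' 1 (M + 2) = 1 :: 2 :: List.range' 3 M := by
  rw [List.range'_succ, List.range'_succ]

theorem eoc_eq_root {a : ℕ} {l r : BinaryTree ℕ} (ht : Increasing (.node a l r))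
    (h : eoc (.node a l r) = a) : l = .nil ∧ r = .nil := by
  by_contra hlr
  exact (lt_eoc ht hlr).ne' h

/-- The root label is squeezed between `a + 1` and the end of the chain, so the chain ends at the
root. -/
theorem eq_leaf_of_eoc {a b : ℕ} {t : BinaryTree ℕ} (ht : Increasing t)
    (hb : rootLabel? t = some b) (hab : a < b) (h : eoc t = a + 1) :
    t = .node (a + 1) .nil .nil := by
  rcases t with _ | ⟨c, l, r⟩
  · simp [rootLabel?] at hb
  · obtain rfl : c = b := by simpa [rootLabel?] using hb
    have := ht.le_of_mem rfl (eoc_mem (t := .node c l r) (by simp))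
    obtain rfl : c = a + 1 := by omega
    obtain ⟨rfl, rfl⟩ := eoc_eq_root ht h
    rfl

/-- If the minimal chain ends at the successor of the root label, it has two nodes. -/
theorem eoc_eq_succ {a : ℕ} {l r : BinaryTree ℕ} (ht : Increasing (.node a l r))
    (h : eoc (.node a l r) = a + 1) :
    l = .node (a + 1) .nil .nil ∨ r = .node (a + 1) .nil .nil := by
  obtain ⟨h1, h2, h3, h4⟩ := increasing_node.1 ht
  rcases slide_eoc_node 0 a l r with ⟨rfl, rfl⟩ | ⟨b, hb, -, -, h'⟩ | ⟨c, hc, -, -, h'⟩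
  · simp [eoc_leaf] at h
  · exact Or.inl (eq_leaf_of_eoc h3 hb (h1 _ (mem_labels_of_rootLabel? hb)) (h' ▸ h))
  · exact Or.inr (eq_leaf_of_eoc h4 hc (h2 _ (mem_labels_of_rootLabel? hc)) (h' ▸ h))

theorem eoc_node_left {a b : ℕ} {l r : BinaryTree ℕ} (hl : rootLabel? l = some b)
    (hr : ∀ c ∈ labels r, b < c) : eoc (.node a l r) = eoc l := by
  rcases hr' : rootLabel? r with _ | c
  · simp [eoc, hl, hr']
  · simp [eoc, hl, hr', hr c (mem_labels_of_rootLabel? hr')]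

theorem eoc_node_right {a c : ℕ} {l r : BinaryTree ℕ} (hr : rootLabel? r = some c)
    (hl : ∀ b ∈ labels l, c < b) : eoc (.node a l r) = eoc r := by
  rcases hl' : rootLabel? l with _ | b
  · simp [eoc, hr, hl']
  · simp [eoc, hr, hl', (hl b (mem_labels_of_rootLabel? hl')).le]

/-- The two subtrees of a secant tree. -/
theorem secantTrees_cases {M : ℕ} {t : BinaryTree ℕ} (ht : t ∈ secantTrees 1 (M + 2)) :
    ∃ l r, t = .node 1 l r ∧ Increasing l ∧ Increasing r ∧ EveryNodeFull l ∧ l ≠ .nil ∧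
      (r = .nil ∨ FullExceptRightmost r) ∧
      (labels l ++ labels r).Perm (2 :: List.range' 3 M) ∧
      (rootLabel? l = some 2 ∨ rootLabel? r = some 2) := by
  obtain ⟨h1, h2, h3⟩ := ht
  have hroot := rootLabel?_eq h1 h2 h3.ne_nil
  rcases t with _ | ⟨a, l, r⟩
  · exact h3.elim
  obtain rfl : a = 1 := by simpa [rootLabel?] using hroot
  obtain ⟨e1, e2, e3, e4⟩ := increasing_node.1 h2
  have hp : (labels l ++ labels r).Perm (2 :: List.range' 3 M) := by
    rw [range'_one_add_two] at h1
    exact List.Perm.cons_inv (List.perm_middle.symm.trans h1)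
  refine ⟨l, r, rfl, e3, e4, h3.2.1, h3.1, h3.2.2, hp, ?_⟩
  have key (t : BinaryTree ℕ) (ht : Increasing t) (hlt : ∀ b ∈ labels t, 1 < b)
      (h2 : 2 ∈ labels t) : rootLabel? t = some 2 := by
    rcases ha : rootLabel? t with _ | a
    · exact absurd (rootLabel?_eq_none.1 ha) (ne_nil_of_mem h2)
    · have := hlt a (mem_labels_of_rootLabel? ha)
      have := ht.le_of_mem ha h2
      rw [show a = 2 by omega]
  have hmem : 2 ∈ labels l ++ labels r := hp.mem_iff.2 List.mem_cons_self
  rcases List.mem_append.1 hmem with h | h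
  · exact Or.inl (key l e3 e1 h)
  · exact Or.inr (key r e4 e2 h)

/-! ### The first top row -/

theorem leaf_two_bijOn {M : ℕ} (hM : 2 ≤ M) :
    Set.BijOn (fun t => .node 1 (.node 2 .nil .nil) t) (secantTrees 3 M)
      {t ∈ secantTrees 1 (M + 2) | eoc t = 2} := by
  refine ⟨fun t ht => ?_, fun t _ t' _ h => by simpa using h, ?_⟩
  · obtain ⟨h1, h2, h3⟩ := ht
    have hlt : ∀ x ∈ labels t, 2 < x := fun x hx => ((mem_labels_iff h1).1 hx).1
    refine ⟨⟨?_, ?_, ?_⟩, ?_⟩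
    · rw [range'_one_add_two]
      exact (List.Perm.swap 1 2 _).trans ((h1.cons 2).cons 1)
    · simp only [increasing_node, labels, List.nil_append, List.mem_singleton, forall_eq]
      exact ⟨by norm_num, fun x hx => by have := hlt x hx; omega, by simp, h2⟩
    · exact ⟨by simp, by simp [EveryNodeFull], Or.inr h3⟩
    · rw [eoc_node_left (b := 2) rfl hlt, eoc_leaf]
  · rintro t ⟨ht, he⟩
    obtain ⟨l, r, rfl, hl, hr, hfl, hl0, hfr, hp, -⟩ := secantTrees_cases ht
    rcases eoc_eq_succ ht.2.1 he with rfl | rfl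
    · refine ⟨r, ⟨List.Perm.cons_inv hp, hr, ?_⟩, rfl⟩
      -- An empty right subtree would leave 2 as the only label besides 1, against `2 ≤ M`.
      rcases hfr with rfl | hfr
      · have := hp.length_eq
        simp [labels] at this
        omega
      · exact hfr
    -- A nonempty right subtree needs a left child at its root, so it is not a single leaf.
    · simp [FullExceptRightmost] at hfr

theorem f_two_eq_ncard {M : ℕ} (hM : 2 ≤ M) (hM' : Even M) (k : ℕ) :
    f (M + 2) 2 k = {t ∈ secantTrees 3 M | parent? (M + 2) t = some k}.ncard := by
  have h := bijOn_sep (leaf_two_bijOn hM) (p := fun t => parent? (M + 2) t = some k)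
    (q := fun t => parent? (M + 2) t = some k) fun t ht => by
      have hroot := rootLabel?_eq ht.1 ht.2.1 ht.2.2.ne_nil
      have h1 : M ≠ 0 := by omega
      have h2 : 3 ≠ M + 2 := by
        rintro h
        obtain rfl : M = 1 := by omega
        omega
      simp [parent?, hroot, h1, h2]
  rw [h.ncard_eq, f_eq (by simpa [Nat.even_add] using hM')]
  simp only [Set.mem_ofPred_eq, and_assoc]

theorem f_two_eq_colSum {M : ℕ} (hM : 2 ≤ M) (hM' : Even M) (k : ℕ) :
    f (M + 2) 2 (k + 2) = colSum M k := by
  rw [f_two_eq_ncard hM hM', colSum_eq hM']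
  refine (bijOn_sep (map_add_bijOn 1 2 M) fun t _ => ?_).ncard_eq.symm
  rw [parent?_map (g := (· + 2)) (add_left_injective 2) M t]
  cases parent? M t <;> simp

/-! ### The second top row -/

/-- Hang the left subtree below a new node `2` with left sibling `3`. -/
def splitLeft : BinaryTree ℕ → BinaryTree ℕ
  | .nil => .nil
  | .node _ l r => .node 1 (.node 2 (.node 3 .nil .nil) l) r

/-- Hang the left subtree below a new node `2` with right sibling `3`. -/
def splitRight : BinaryTree ℕ → BinaryTree ℕ
  | .nil => .nil
  | .node _ l r => .node 1 (.node 2 l (.node 3 .nil .nil)) r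

/-- Hang the right subtree below a new node `2` with left sibling `3`. -/
def splitBelow : BinaryTree ℕ → BinaryTree ℕ
  | .nil => .nil
  | .node _ l r => .node 1 l (.node 2 (.node 3 .nil .nil) r)

/-- The root inequalities can be dropped: 3 is the least of the labels, each used once. -/
theorem mem_secantTrees_three {M : ℕ} {l r : BinaryTree ℕ} :
    .node 3 l r ∈ secantTrees 3 M ↔
      (labels l ++ 3 :: labels r).Perm (List.range' 3 M) ∧ Increasing l ∧ Increasing r ∧
        l ≠ .nil ∧ EveryNodeFull l ∧ (r = .nil ∨ FullExceptRightmost r) := by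
  simp only [secantTrees, Set.mem_ofPred_eq, increasing_node, FullExceptRightmost]
  constructor
  · rintro ⟨h1, ⟨h2, h3, h4, h5⟩, h6⟩
    exact ⟨h1, h4, h5, h6⟩
  · rintro ⟨h1, h4, h5, h6⟩
    have hn : (labels (.node 3 l r)).Nodup := nodup_labels (c := 3) (N := M) h1
    obtain ⟨-, -, hl, hr, -⟩ := nodup_node hn
    refine ⟨h1, ⟨fun b hb => ?_, fun b hb => ?_, h4, h5⟩, h6⟩
    · have : b ∈ List.range' 3 M := h1.mem_iff.1 (by simp [hb])
      rw [List.mem_range'_1] at this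
      exact lt_of_le_of_ne this.1 (by rintro rfl; exact hl hb)
    · have : b ∈ List.range' 3 M := h1.mem_iff.1 (by simp [hb])
      rw [List.mem_range'_1] at this
      exact lt_of_le_of_ne this.1 (by rintro rfl; exact hr hb)

theorem exists_of_mem_secantTrees_three {M : ℕ} {t : BinaryTree ℕ} (ht : t ∈ secantTrees 3 M) :
    ∃ l r, t = .node 3 l r ∧ (∀ x ∈ labels l, 3 < x) ∧ (∀ x ∈ labels r, 3 < x) := by
  have hroot := rootLabel?_eq ht.1 ht.2.1 ht.2.2.ne_nil
  rcases t with _ | ⟨a, l, r⟩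
  · exact ht.2.2.elim
  · obtain rfl : a = 3 := by simpa [rootLabel?] using hroot
    obtain ⟨h1, h2, -, -⟩ := increasing_node.1 ht.2.1
    exact ⟨l, r, rfl, h1, h2⟩

theorem three_lt {M : ℕ} {l r : BinaryTree ℕ} (ht : .node 3 l r ∈ secantTrees 3 M) :
    (∀ x ∈ labels l, 3 < x) ∧ (∀ x ∈ labels r, 3 < x) := by
  obtain ⟨_, _, h, h1, h2⟩ := exists_of_mem_secantTrees_three ht
  cases h
  exact ⟨h1, h2⟩

theorem perm_of_count {l l' : List ℕ} (h : ∀ a, l.count a = l'.count a) : l.Perm l' :=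
  List.perm_iff_count.2 h

theorem labels_splitLeft (l r : BinaryTree ℕ) :
    (labels (splitLeft (.node 3 l r))).Perm (1 :: 2 :: labels (.node 3 l r)) := by
  refine perm_of_count fun a => ?_
  simp only [splitLeft, labels, List.count_append, List.count_cons, List.count_nil]
  omega

theorem labels_splitRight (l r : BinaryTree ℕ) :
    (labels (splitRight (.node 3 l r))).Perm (1 :: 2 :: labels (.node 3 l r)) := by
  refine perm_of_count fun a => ?_
  simp only [splitRight, labels, List.count_append, List.count_cons, List.count_nil]
  omega

theorem labels_splitBelow (l r : BinaryTree ℕ) :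
    (labels (splitBelow (.node 3 l r))).Perm (1 :: 2 :: labels (.node 3 l r)) := by
  refine perm_of_count fun a => ?_
  simp only [splitBelow, labels, List.count_append, List.count_cons, List.count_nil]
  omega

theorem perm_iff_of_perm_cons {M : ℕ} {L L' : List ℕ} (h : L.Perm (1 :: 2 :: L')) :
    L.Perm (List.range' 1 (M + 2)) ↔ L'.Perm (List.range' 3 M) := by
  rw [range'_one_add_two]
  exact ⟨fun h' => (h.symm.trans h').cons_inv.cons_inv, fun h' => h.trans ((h'.cons 2).cons 1)⟩

theorem splitLeft_mem {M : ℕ} {l r : BinaryTree ℕ} (ht : .node 3 l r ∈ secantTrees 3 M) :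
    splitLeft (.node 3 l r) ∈ secantTrees 1 (M + 2) ∧ eoc (splitLeft (.node 3 l r)) = 3 := by
  obtain ⟨hl, hr⟩ := three_lt ht
  obtain ⟨h1, h4, h5, h6, h7, h8⟩ := mem_secantTrees_three.1 ht
  refine ⟨⟨(perm_iff_of_perm_cons (labels_splitLeft l r)).2 h1, ?_, ?_⟩, ?_⟩
  · simp only [splitLeft, increasing_node, labels, List.nil_append, List.mem_append,
      List.mem_cons, List.not_mem_nil, or_false]
    refine ⟨?_, fun x hx => by have := hr x hx; omega, ⟨by simp, fun x hx => by
      have := hl x hx; omega, by simp, h4⟩, h5⟩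
    rintro x (rfl | rfl | hx)
    · omega
    · omega
    · have := hl x hx; omega
  · simp [splitLeft, FullExceptRightmost, EveryNodeFull, h6, h7, h8]
  · rw [splitLeft, eoc_node_left (b := 2) rfl fun x hx => by have := hr x hx; omega,
      eoc_node_left (b := 3) rfl hl, eoc_leaf]

theorem splitRight_mem {M : ℕ} {l r : BinaryTree ℕ} (ht : .node 3 l r ∈ secantTrees 3 M) :
    splitRight (.node 3 l r) ∈ secantTrees 1 (M + 2) ∧ eoc (splitRight (.node 3 l r)) = 3 := by
  obtain ⟨hl, hr⟩ := three_lt ht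
  obtain ⟨h1, h4, h5, h6, h7, h8⟩ := mem_secantTrees_three.1 ht
  refine ⟨⟨(perm_iff_of_perm_cons (labels_splitRight l r)).2 h1, ?_, ?_⟩, ?_⟩
  · simp only [splitRight, increasing_node, labels, List.nil_append, List.mem_append,
      List.mem_cons, List.not_mem_nil, or_false]
    refine ⟨?_, fun x hx => by have := hr x hx; omega, ⟨fun x hx => by
      have := hl x hx; omega, by simp, h4, by simp⟩, h5⟩
    rintro x (hx | rfl | rfl)
    · have := hl x hx; omega
    · omega
    · omega
  · simp [splitRight, FullExceptRightmost, EveryNodeFull, h6, h7, h8]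
  · rw [splitRight, eoc_node_left (b := 2) rfl fun x hx => by have := hr x hx; omega,
      eoc_node_right (c := 3) rfl hl, eoc_leaf]

theorem splitBelow_mem {M : ℕ} {l r : BinaryTree ℕ} (ht : .node 3 l r ∈ secantTrees 3 M) :
    splitBelow (.node 3 l r) ∈ secantTrees 1 (M + 2) ∧ eoc (splitBelow (.node 3 l r)) = 3 := by
  obtain ⟨hl, hr⟩ := three_lt ht
  obtain ⟨h1, h4, h5, h6, h7, h8⟩ := mem_secantTrees_three.1 ht
  refine ⟨⟨(perm_iff_of_perm_cons (labels_splitBelow l r)).2 h1, ?_, ?_⟩, ?_⟩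
  · simp only [splitBelow, increasing_node, labels, List.nil_append, List.mem_append,
      List.mem_cons, List.not_mem_nil, or_false]
    refine ⟨fun x hx => by have := hl x hx; omega, ?_, h4, ⟨by simp, fun x hx => by
      have := hr x hx; omega, by simp, h5⟩⟩
    rintro x (rfl | rfl | hx)
    · omega
    · omega
    · have := hr x hx; omega
  · simp [splitBelow, FullExceptRightmost, EveryNodeFull, h6, h7, h8]
  · rw [splitBelow, eoc_node_right (c := 2) rfl fun x hx => by have := hl x hx; omega,
      eoc_node_left (b := 3) rfl hr, eoc_leaf]

/-- Every secant tree with `eoc = 3` arises by one of the three splittings. -/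
theorem exists_split {M : ℕ} {t : BinaryTree ℕ} (ht : t ∈ secantTrees 1 (M + 2))
    (he : eoc t = 3) :
    ∃ l r, .node 3 l r ∈ secantTrees 3 M ∧
      (t = splitLeft (.node 3 l r) ∨ t = splitRight (.node 3 l r) ∨
        t = splitBelow (.node 3 l r)) := by
  obtain ⟨l, r, rfl, hl, hr, hfl, hl0, hfr, hp, h2⟩ := secantTrees_cases ht
  have hnd : (labels l ++ labels r).Nodup :=
    hp.nodup_iff.2 (by rw [← List.range'_succ (s := 2) (step := 1)]; exact List.nodup_range')
  have hge : ∀ x ∈ labels l ++ labels r, 2 ≤ x := fun x hx => by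
    have := hp.mem_iff.1 hx
    rw [← List.range'_succ (s := 2) (step := 1), List.mem_range'_1] at this
    exact this.1
  rcases h2 with h2 | h2
  · have hlt : ∀ x ∈ labels r, 2 < x := fun x hx => by
      refine lt_of_le_of_ne (hge x (List.mem_append_right _ hx)) ?_
      rintro rfl
      exact List.disjoint_of_nodup_append hnd (mem_labels_of_rootLabel? h2) hx
    rw [eoc_node_left h2 hlt] at he
    rcases l with _ | ⟨a, A, B⟩
    · simp at hl0
    obtain rfl : a = 2 := by simpa [rootLabel?] using h2
    obtain ⟨-, -, hA, hB⟩ := increasing_node.1 hl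
    obtain ⟨hAB, hfA, hfB⟩ := hfl
    -- A childless node 2 would end the chain at 2. Hence the sibling of 3 is nonempty and can serve
    -- as the left subtree of the new root 3.
    have hAB' : A ≠ .nil ∧ B ≠ .nil := by
      rw [Ne, Ne, ← hAB, and_self]
      intro h
      rw [h, hAB.1 h, eoc_leaf] at he
      omega
    rcases eoc_eq_succ hl he with rfl | rfl
    · refine ⟨B, r, ?_, Or.inl rfl⟩
      exact mem_secantTrees_three.2
        ⟨(perm_iff_of_perm_cons (labels_splitLeft B r)).1 ht.1, hB, hr, hAB'.2, hfB, hfr⟩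
    · refine ⟨A, r, ?_, Or.inr (Or.inl rfl)⟩
      exact mem_secantTrees_three.2
        ⟨(perm_iff_of_perm_cons (labels_splitRight A r)).1 ht.1, hA, hr, hAB'.1, hfA, hfr⟩
  · have hlt : ∀ x ∈ labels l, 2 < x := fun x hx => by
      refine lt_of_le_of_ne (hge x (List.mem_append_left _ hx)) ?_
      rintro rfl
      exact List.disjoint_of_nodup_append hnd hx (mem_labels_of_rootLabel? h2)
    rw [eoc_node_right h2 hlt] at he
    rcases r with _ | ⟨a, A, B⟩
    · simp [rootLabel?] at h2
    obtain rfl : a = 2 := by simpa [rootLabel?] using h2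
    obtain ⟨-, -, hA, hB⟩ := increasing_node.1 hr
    have hfr' : FullExceptRightmost (.node 2 A B) := by simpa using hfr
    rcases eoc_eq_succ hr he with rfl | rfl
    · refine ⟨l, B, ?_, Or.inr (Or.inr rfl)⟩
      exact mem_secantTrees_three.2
        ⟨(perm_iff_of_perm_cons (labels_splitBelow l B)).1 ht.1, hl, hB, hl0, hfl, hfr'.2.2⟩
    -- Here 2 lies on the rightmost path, where a right child must itself have a left child; the
    -- leaf 3 can only be on the left, so this side yields one splitting instead of two.
    · simp [FullExceptRightmost] at hfr'

/-- Parents inside `l` and `r` are untouched. If M + 2 is the root of `l`, its parent is 3 before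
and 1 or 2 after the splitting, all excluded by `4 ≤ k`. -/
theorem parent?_split {M k : ℕ} (hM : 2 ≤ M) (hk : 4 ≤ k) {l r : BinaryTree ℕ}
    (ht : .node 3 l r ∈ secantTrees 3 M) :
    (parent? (M + 2) (splitLeft (.node 3 l r)) = some k ↔
      parent? (M + 2) (.node 3 l r) = some k) ∧
    (parent? (M + 2) (splitRight (.node 3 l r)) = some k ↔
      parent? (M + 2) (.node 3 l r) = some k) ∧
    (parent? (M + 2) (splitBelow (.node 3 l r)) = some k ↔
      parent? (M + 2) (.node 3 l r) = some k) := by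
  -- The maximum is a leaf, whereas a nonempty `r` has a left child at its root.
  have hr : rootLabel? r ≠ some (M + 2) := by
    intro hr
    rcases r with _ | ⟨a, A, B⟩
    · simp [rootLabel?] at hr
    · obtain rfl : a = M + 2 := by simpa [rootLabel?] using hr
      obtain ⟨-, -, -, hinc⟩ := increasing_node.1 ht.2.1
      have hA := (children_eq_nil hinc fun z hz => by
        have := (mem_labels_iff ht.1 (x := z)).1 (by simp [labels] at hz ⊢; tauto)
        omega).1
      have := ht.2.2.2.2
      simp [hA, FullExceptRightmost] at this
  have h2 : M ≠ 0 := by omega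
  have hM3 : ¬(3 = M + 2) := by
    intro h
    obtain rfl : M = 1 := by omega
    omega
  have k1 : ¬(1 = k) := by omega
  have k2 : ¬(2 = k) := by omega
  have k3 : ¬(3 = k) := by omega
  by_cases hl : rootLabel? l = some (M + 2) <;>
    simp [parent?, splitLeft, splitRight, splitBelow, hr, hl, h2, hM3, k1, k2, k3]

theorem f_three_eq {M k : ℕ} (hM : 2 ≤ M) (hM' : Even M) (hk : 4 ≤ k) :
    f (M + 2) 3 k = 3 * f (M + 2) 2 k := by
  rw [f_two_eq_ncard hM hM', f_eq (by simpa [Nat.even_add] using hM')]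
  set G := {t ∈ secantTrees 3 M | parent? (M + 2) t = some k} with hG
  have hfin : G.Finite := by
    have := (finite_secantTrees hM').image (BinaryTree.map (· + 2))
    rw [(map_add_bijOn 1 2 M).image_eq] at this
    exact this.subset fun _ h => h.1
  have heq : {t ∈ secantTrees 1 (M + 2) | eoc t = 3 ∧ parent? (M + 2) t = some k} =
      splitLeft '' G ∪ (splitRight '' G ∪ splitBelow '' G) := by
    ext t
    constructor
    · rintro ⟨ht, he, hp⟩
      obtain ⟨l, r, hlr, h⟩ := exists_split ht he
      obtain ⟨p1, p2, p3⟩ := parent?_split hM hk hlr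
      rcases h with rfl | rfl | rfl
      · exact Or.inl ⟨_, ⟨hlr, p1.1 hp⟩, rfl⟩
      · exact Or.inr (Or.inl ⟨_, ⟨hlr, p2.1 hp⟩, rfl⟩)
      · exact Or.inr (Or.inr ⟨_, ⟨hlr, p3.1 hp⟩, rfl⟩)
    · rintro (⟨t, ⟨ht, hp⟩, rfl⟩ | ⟨t, ⟨ht, hp⟩, rfl⟩ | ⟨t, ⟨ht, hp⟩, rfl⟩) <;>
        obtain ⟨l, r, rfl, -, -⟩ := exists_of_mem_secantTrees_three ht <;>
        obtain ⟨p1, p2, p3⟩ := parent?_split hM hk ht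
      · exact ⟨(splitLeft_mem ht).1, (splitLeft_mem ht).2, p1.2 hp⟩
      · exact ⟨(splitRight_mem ht).1, (splitRight_mem ht).2, p2.2 hp⟩
      · exact ⟨(splitBelow_mem ht).1, (splitBelow_mem ht).2, p3.2 hp⟩
  have hinj : Set.InjOn splitLeft G ∧ Set.InjOn splitRight G ∧ Set.InjOn splitBelow G := by
    refine ⟨?_, ?_, ?_⟩ <;> rintro t ⟨ht, -⟩ t' ⟨ht', -⟩ h <;>
      obtain ⟨l, r, rfl, -, -⟩ := exists_of_mem_secantTrees_three ht <;>
      obtain ⟨l', r', rfl, -, -⟩ := exists_of_mem_secantTrees_three ht' <;>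
      simpa [splitLeft, splitRight, splitBelow] using h
  -- The labels of `l` and `r` exceed 3, so the positions of 2 and 3 reveal which splitting was
  -- used.
  have hd1 : Disjoint (splitRight '' G) (splitBelow '' G) := by
    rw [Set.disjoint_left]
    rintro _ ⟨t, ⟨ht, -⟩, rfl⟩ ⟨t', ⟨ht', -⟩, h⟩
    obtain ⟨l, r, rfl, hl, hr⟩ := exists_of_mem_secantTrees_three ht
    obtain ⟨l', r', rfl, hl', hr'⟩ := exists_of_mem_secantTrees_three ht'
    simp only [splitRight, splitBelow, BinaryTree.node.injEq, true_and] at h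
    have := hr 2 (by simp [← h.2, labels])
    omega
  have hd2 : Disjoint (splitLeft '' G) (splitRight '' G ∪ splitBelow '' G) := by
    rw [Set.disjoint_left]
    rintro _ ⟨t, ⟨ht, -⟩, rfl⟩ (⟨t', ⟨ht', -⟩, h⟩ | ⟨t', ⟨ht', -⟩, h⟩) <;>
      obtain ⟨l, r, rfl, hl, hr⟩ := exists_of_mem_secantTrees_three ht <;>
      obtain ⟨l', r', rfl, hl', hr'⟩ := exists_of_mem_secantTrees_three ht' <;>
      simp only [splitLeft, splitRight, splitBelow, BinaryTree.node.injEq, true_and] at h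
    · have := hl 3 (by simp [← h.1.2, labels])
      omega
    · have := hr 2 (by simp [← h.2, labels])
      omega
  rw [heq, Set.ncard_union_eq hd2 (hfin.image _) ((hfin.image _).union (hfin.image _)),
    Set.ncard_union_eq hd1 (hfin.image _) (hfin.image _), hinj.1.ncard_image,
    hinj.2.1.ncard_image, hinj.2.2.ncard_image]
  ring

/-! ### Subtrees, substitution and grafting -/

/-- The subtree whose root is labeled `x`. -/
def subtreeAt (x : ℕ) : BinaryTree ℕ → BinaryTree ℕ
  | .nil => .nil
  | .node a l r =>
      if a = x then .node a l r else if x ∈ labels l then subtreeAt x l else subtreeAt x r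

/-- Replace the subtree whose root is labeled `x` by `s`. -/
def subst (x : ℕ) (s : BinaryTree ℕ) : BinaryTree ℕ → BinaryTree ℕ
  | .nil => .nil
  | .node a l r => if a = x then s else .node a (subst x s l) (subst x s r)

/-- Attach `s` as the right subtree of the rightmost node. -/
def attach (s : BinaryTree ℕ) : BinaryTree ℕ → BinaryTree ℕ
  | .nil => s
  | .node a l r => .node a l (attach s r)

theorem subst_of_notMem {x : ℕ} {s t : BinaryTree ℕ} (h : x ∉ labels t) : subst x s t = t := by
  induction t with
  | nil => rfl
  | node a l r hl hr =>
    simp only [labels, List.mem_append, List.mem_cons, not_or] at h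
    rw [subst, if_neg (Ne.symm h.2.1), hl h.1, hr h.2.2]

theorem rootLabel?_subst {x : ℕ} {s : BinaryTree ℕ} (hs : rootLabel? s = some x)
    (t : BinaryTree ℕ) : rootLabel? (subst x s t) = rootLabel? t := by
  cases t with
  | nil => rfl
  | node a l r =>
    rw [subst]
    split_ifs with h
    · rw [hs, rootLabel?_node, h]
    · rfl

theorem subst_eq_nil {x : ℕ} {s : BinaryTree ℕ} (hs : rootLabel? s = some x)
    {t : BinaryTree ℕ} : subst x s t = .nil ↔ t = .nil := by
  rw [← rootLabel?_eq_none, rootLabel?_subst hs, rootLabel?_eq_none]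

theorem mem_subst {x : ℕ} {s t : BinaryTree ℕ} (hs : rootLabel? s = some x)
    (h : x ∈ labels t) : x ∈ labels (subst x s t) := by
  induction t with
  | nil => simp [labels] at h
  | node a l r hl hr =>
    rw [subst]
    split_ifs with ha
    · exact mem_labels_of_rootLabel? hs
    · simp only [labels, List.mem_append, List.mem_cons] at h ⊢
      rcases h with h | h | h
      · exact Or.inl (hl h)
      · exact absurd h.symm ha
      · exact Or.inr (Or.inr (hr h))

theorem mem_of_mem_subst {x y : ℕ} {s t : BinaryTree ℕ} (h : y ∈ labels (subst x s t)) :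
    y ∈ labels t ∨ (x ∈ labels t ∧ y ∈ labels s) := by
  induction t with
  | nil => exact Or.inl h
  | node a l r hl hr =>
    rw [subst] at h
    split_ifs at h with ha
    · exact Or.inr ⟨by simp [labels, ha], h⟩
    · simp only [labels, List.mem_append, List.mem_cons] at h ⊢
      rcases h with h | h | h
      · have := hl h; tauto
      · tauto
      · have := hr h; tauto

/-- Substitution is reversible because `s` again has root `x`, which marks the place. -/
theorem subst_subtreeAt {x : ℕ} {s t : BinaryTree ℕ} (hs : rootLabel? s = some x)
    (hn : (labels t).Nodup) : subst x (subtreeAt x t) (subst x s t) = t := by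
  induction t with
  | nil => rfl
  | node a l r hl hr =>
    obtain ⟨n1, n2, -, -, hd⟩ := nodup_node hn
    rw [subst, subtreeAt]
    split_ifs with ha h
    · cases s with
      | nil => simp at hs
      | node b _ _ =>
        rw [rootLabel?_node, Option.some.injEq] at hs
        rw [subst, if_pos hs]
    · rw [subst, if_neg ha, hl n1, subst_of_notMem (t := r) (hd x h), subst_of_notMem (hd x h)]
    · rw [subst, if_neg ha, hr n2, subst_of_notMem (t := l) h, subst_of_notMem h]

theorem subtreeAt_subst {x : ℕ} {s t : BinaryTree ℕ} (hs : rootLabel? s = some x)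
    (hx : x ∈ labels t) : subtreeAt x (subst x s t) = s := by
  induction t with
  | nil => simp [labels] at hx
  | node a l r hl hr =>
    rw [subst]
    split_ifs with ha
    · cases s with
      | nil => simp at hs
      | node b _ _ =>
        rw [rootLabel?_node, Option.some.injEq] at hs
        rw [subtreeAt, if_pos hs]
    · rw [subtreeAt, if_neg ha]
      by_cases h : x ∈ labels l
      · rw [if_pos (mem_subst hs h), hl h]
      · rw [subst_of_notMem h, if_neg h]
        simp only [labels, List.mem_append, List.mem_cons] at hx
        exact hr (by tauto)

theorem labels_subst {x : ℕ} (s : BinaryTree ℕ) {t : BinaryTree ℕ}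
    (hn : (labels t).Nodup) (hx : x ∈ labels t) :
    (labels (subst x s t) ++ labels (subtreeAt x t)).Perm (labels s ++ labels t) := by
  induction t with
  | nil => simp [labels] at hx
  | node a l r hl hr =>
    obtain ⟨n1, n2, -, -, hd⟩ := nodup_node hn
    simp only [labels, List.mem_append, List.mem_cons] at hx
    rw [subst, subtreeAt]
    refine perm_of_count fun c => ?_
    split_ifs with ha h
    · rfl
    · have := List.perm_iff_count.1 (hl n1 h) c
      rw [subst_of_notMem (hd x h)]
      simp only [labels, List.count_append, List.count_cons] at this ⊢
      omega
    · have := List.perm_iff_count.1 (hr n2 (by tauto)) c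
      rw [subst_of_notMem h]
      simp only [labels, List.count_append, List.count_cons] at this ⊢
      omega

theorem increasing_subst {x : ℕ} {s t : BinaryTree ℕ} (hs : rootLabel? s = some x)
    (hsi : Increasing s) (ht : Increasing t) : Increasing (subst x s t) := by
  induction t with
  | nil => exact ht
  | node a l r hl hr =>
    obtain ⟨h1, h2, h3, h4⟩ := increasing_node.1 ht
    rw [subst]
    split_ifs with ha
    · exact hsi
    · rw [increasing_node]
      refine ⟨fun y hy => ?_, fun y hy => ?_, hl h3, hr h4⟩
      · rcases mem_of_mem_subst hy with hy | ⟨hx, hy⟩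
        · exact h1 y hy
        · exact (h1 x hx).trans_le (hsi.le_of_mem hs hy)
      · rcases mem_of_mem_subst hy with hy | ⟨hx, hy⟩
        · exact h2 y hy
        · exact (h2 x hx).trans_le (hsi.le_of_mem hs hy)

theorem everyNodeFull_subst {x : ℕ} {s t : BinaryTree ℕ} (hs : rootLabel? s = some x)
    (hsf : EveryNodeFull s) (ht : EveryNodeFull t) : EveryNodeFull (subst x s t) := by
  induction t with
  | nil => exact ht
  | node a l r hl hr =>
    rw [subst]
    split_ifs with ha
    · exact hsf
    · exact ⟨by rw [subst_eq_nil hs, subst_eq_nil hs, ht.1], hl ht.2.1, hr ht.2.2⟩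

theorem FullExceptRightmost.not_everyNodeFull {t : BinaryTree ℕ} (h : FullExceptRightmost t) :
    ¬ EveryNodeFull t := by
  induction t with
  | nil => exact h.elim
  | node a l r _ hr =>
    rintro ⟨h1, -, h3⟩
    rcases h.2.2 with hr' | hr'
    · exact h.1 (h1.2 hr')
    · exact hr hr' h3

/-- Subtrees rooted on the rightmost path are never full, so the replaced subtree hangs off that
path, where only fullness matters. -/
theorem fullExceptRightmost_subst {x : ℕ} {s t : BinaryTree ℕ} (hs : rootLabel? s = some x)
    (hsf : EveryNodeFull s) (hn : (labels t).Nodup) (ht : FullExceptRightmost t)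
    (hx : EveryNodeFull (subtreeAt x t)) : FullExceptRightmost (subst x s t) := by
  induction t with
  | nil => exact ht
  | node a l r _ hr =>
    obtain ⟨n1, n2, -, -, hd⟩ := nodup_node hn
    rw [subtreeAt] at hx
    rw [subst]
    split_ifs at hx ⊢ with ha h
    · exact absurd hx ht.not_everyNodeFull
    · rw [subst_of_notMem (hd x h)]
      exact ⟨by rw [Ne, subst_eq_nil hs]; exact ht.1, everyNodeFull_subst hs hsf ht.2.1, ht.2.2⟩
    · rw [subst_of_notMem h]
      refine ⟨ht.1, ht.2.1, ?_⟩
      rcases ht.2.2 with rfl | hr'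
      · exact Or.inl rfl
      · exact Or.inr (hr n2 hr' hx)

theorem eoc_congr {a : ℕ} {l r l' r' : BinaryTree ℕ} (hl : rootLabel? l = rootLabel? l')
    (hr : rootLabel? r = rootLabel? r') {m : ℕ} (h1 : eoc l = m ↔ eoc l' = m)
    (h2 : eoc r = m ↔ eoc r' = m) :
    eoc (.node a l r) = m ↔ eoc (.node a l' r') = m := by
  rw [eoc, eoc, hl, hr]
  rcases rootLabel? l' with _ | b <;> rcases rootLabel? r' with _ | c <;> simp only
  · exact h2
  · exact h1
  · split_ifs
    · exact h1
    · exact h2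

theorem le_eoc {t : BinaryTree ℕ} {a : ℕ} (ht : Increasing t) (ha : rootLabel? t = some a) :
    a ≤ eoc t :=
  ht.le_of_mem ha (eoc_mem (ne_nil_of_mem (mem_labels_of_rootLabel? ha)))

/-- A chain that enters the subtree at `x` ends at a label at least `x`, both before and after;
other chains are unchanged. -/
theorem eoc_subst {x m : ℕ} {s t : BinaryTree ℕ} (hs : rootLabel? s = some x)
    (hsi : Increasing s) (ht : Increasing t) (hm : m < x) : eoc (subst x s t) = m ↔ eoc t = m := by
  induction t with
  | nil => rfl
  | node a l r hl hr =>
    obtain ⟨-, -, h3, h4⟩ := increasing_node.1 ht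
    rw [subst]
    split_ifs with ha
    · have e1 := le_eoc hsi hs
      have e2 := le_eoc ht (rootLabel?_node a l r)
      exact ⟨fun h => by omega, fun h => by omega⟩
    · exact eoc_congr (rootLabel?_subst hs l) (rootLabel?_subst hs r) (hl h3) (hr h4)

theorem labels_attach (s t : BinaryTree ℕ) : labels (attach s t) = labels t ++ labels s := by
  induction t with
  | nil => rfl
  | node a l r _ hr => simp [attach, labels, hr]

theorem attach_injective (s : BinaryTree ℕ) : Function.Injective (attach s) := by
  intro t t' h
  induction t generalizing t' with
  | nil =>
    have := congrArg (fun t => (labels t).length) h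
    simp only [labels_attach, List.length_append, labels, List.length_nil] at this
    exact (labels_eq_nil.1 (List.length_eq_zero_iff.1 (by omega))).symm
  | node a l r _ hr =>
    cases t' with
    | nil =>
      have := congrArg (fun t => (labels t).length) h
      simp only [labels_attach, List.length_append, labels, List.length_nil,
        List.length_cons] at this
      omega
    | node a' l' r' =>
      simp only [attach, BinaryTree.node.injEq] at h
      rw [h.1, h.2.1, hr h.2.2]

theorem fullExceptRightmost_attach {s t : BinaryTree ℕ} (ht : FullExceptRightmost t)
    (hs : FullExceptRightmost s) : FullExceptRightmost (attach s t) := by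
  induction t with
  | nil => exact hs
  | node a l r _ hr =>
    refine ⟨ht.1, ht.2.1, Or.inr ?_⟩
    rcases ht.2.2 with rfl | h
    · exact hs
    · exact hr h

/-- Grafting `s` keeps a tree increasing if the labels of `s` are larger than all non-maximal labels
of the tree. -/
theorem increasing_attach {s t : BinaryTree ℕ} (ht : FullExceptRightmost t) (hti : Increasing t)
    (hsi : Increasing s)
    (h : ∀ a ∈ labels t, ∀ b ∈ labels t, a < b → ∀ c ∈ labels s, a < c) :
    Increasing (attach s t) := by
  induction t with
  | nil => exact ht.elim
  | node a l r _ hr =>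
    obtain ⟨h1, h2, h3, h4⟩ := increasing_node.1 hti
    -- A node on the rightmost path has a left child, so its label is not maximal and the hypothesis
    -- applies.
    have hal : ∀ c ∈ labels s, a < c := by
      have hb := eoc_mem ht.1
      exact h a (by simp [labels]) (eoc l) (by simp [labels, hb]) (h1 _ hb)
    rw [attach, increasing_node]
    refine ⟨h1, fun y hy => ?_, h3, ?_⟩
    · rw [labels_attach, List.mem_append] at hy
      rcases hy with hy | hy
      · exact h2 y hy
      · exact hal y hy
    · rcases ht.2.2 with rfl | hfr
      · exact hsi
      · exact hr hfr h4 fun a ha b hb => h a (by simp [labels, ha]) b (by simp [labels, hb])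

theorem rootLabel?_attach {s t : BinaryTree ℕ} (ht : t ≠ .nil) :
    rootLabel? (attach s t) = rootLabel? t := by
  cases t with
  | nil => exact absurd rfl ht
  | node a l r => rfl

theorem eoc_attach {x m : ℕ} {s t : BinaryTree ℕ} (hs : rootLabel? s = some x)
    (hsi : Increasing s) (ht : FullExceptRightmost t) (hti : Increasing t) (hm : m < x) :
    eoc (attach s t) = m ↔ eoc t = m := by
  induction t with
  | nil => exact ht.elim
  | node a l r _ hr =>
    obtain ⟨-, -, h3, h4⟩ := increasing_node.1 hti
    rcases ht.2.2 with rfl | hfr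
    · have hx := le_eoc hsi hs
      rcases hl : rootLabel? l with _ | b
      · exact absurd (rootLabel?_eq_none.1 hl) ht.1
      · have hb := le_eoc h3 hl
        -- The chain at the old rightmost node either still goes left, or turns into `s` because the
        -- left child is at least `x`; in the latter case both ends are at least `x > m`.
        simp only [attach, eoc, hl, hs, rootLabel?_nil]
        split_ifs with h
        · rfl
        · exact ⟨fun h => by omega, fun h => by omega⟩
    · exact eoc_congr rfl (rootLabel?_attach hfr.ne_nil) Iff.rfl (hr hfr h4)

theorem subtreeAt_of_rootLabel? {x : ℕ} {t : BinaryTree ℕ} (h : rootLabel? t = some x) :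
    subtreeAt x t = t := by
  cases t with
  | nil => rfl
  | node a l r =>
    rw [rootLabel?_node, Option.some.injEq] at h
    rw [subtreeAt, if_pos h]

theorem subtreeAt_attach {x : ℕ} {s t : BinaryTree ℕ} (hs : rootLabel? s = some x)
    (hx : x ∉ labels t) : subtreeAt x (attach s t) = s := by
  induction t with
  | nil => exact subtreeAt_of_rootLabel? hs
  | node a l r _ hr =>
    simp only [labels, List.mem_append, List.mem_cons, not_or] at hx
    rw [attach, subtreeAt, if_neg (Ne.symm hx.2.1), if_neg hx.1, hr hx.2.2]

theorem increasing_subtreeAt {t : BinaryTree ℕ} (ht : Increasing t) (x : ℕ) :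
    Increasing (subtreeAt x t) := by
  induction t with
  | nil => exact ht
  | node a l r hl hr =>
    rw [subtreeAt]
    split_ifs
    · exact ht
    · exact hl ht.2.2.1
    · exact hr ht.2.2.2

theorem everyNodeFull_subtreeAt {t : BinaryTree ℕ} (ht : EveryNodeFull t) (x : ℕ) :
    EveryNodeFull (subtreeAt x t) := by
  induction t with
  | nil => exact ht
  | node a l r hl hr =>
    rw [subtreeAt]
    split_ifs
    · exact ht
    · exact hl ht.2.1
    · exact hr ht.2.2

/-- The alternative is whether `x` lies off or on the rightmost path; an absent `x` gives the empty
subtree, which counts as full. -/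
theorem subtreeAt_cases {t : BinaryTree ℕ} (ht : FullExceptRightmost t) (x : ℕ) :
    EveryNodeFull (subtreeAt x t) ∨
      (FullExceptRightmost (subtreeAt x t) ∧
        (t = subtreeAt x t ∨
          ∃ t', FullExceptRightmost t' ∧ t = attach (subtreeAt x t) t')) := by
  induction t with
  | nil => exact ht.elim
  | node a l r _ hr =>
    rw [subtreeAt]
    split_ifs
    · exact Or.inr ⟨ht, Or.inl rfl⟩
    · exact Or.inl (everyNodeFull_subtreeAt ht.2.1 x)
    · rcases ht.2.2 with rfl | hfr
      · exact Or.inl trivial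
      · rcases hr hfr with h | ⟨h1, h2 | ⟨t', h2, h3⟩⟩
        · exact Or.inl h
        · exact Or.inr ⟨h1, Or.inr ⟨.node a l .nil, ⟨ht.1, ht.2.1, Or.inl rfl⟩, by
            rw [attach, attach, ← h2]⟩⟩
        · exact Or.inr ⟨h1, Or.inr ⟨.node a l t', ⟨ht.1, ht.2.1, Or.inr h2⟩, by
            rw [attach, ← h3]⟩⟩

theorem subtreeAt_sublist {t : BinaryTree ℕ} (x : ℕ) :
    (labels (subtreeAt x t)).Sublist (labels t) := by
  induction t with
  | nil => exact List.Sublist.refl _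
  | node a l r hl hr =>
    rw [subtreeAt]
    split_ifs
    · exact List.Sublist.refl _
    · exact hl.trans (List.sublist_append_left _ _)
    · exact hr.trans ((List.sublist_cons_self _ _).trans (List.sublist_append_right _ _))

theorem subtreeAt_parent {x k : ℕ} {t : BinaryTree ℕ} (hn : (labels t).Nodup)
    (h : parent? x t = some k) :
    ∃ l r, subtreeAt k t = .node k l r ∧ (rootLabel? l = some x ∨ rootLabel? r = some x) := by
  induction t with
  | nil => simp [parent?] at h
  | node a l r hl hr =>
    obtain ⟨n1, n2, n3, n4, hd⟩ := nodup_node hn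
    rw [parent?] at h
    split_ifs at h with h'
    · obtain rfl : a = k := by simpa using h
      exact ⟨l, r, by simp [subtreeAt], h'⟩
    · rw [subtreeAt]
      rcases Option.or_eq_some_iff.1 h with h | ⟨-, h⟩
      · have hk := parent_mem h
        rw [if_neg (by rintro rfl; exact n3 hk), if_pos hk]
        exact hl n1 h
      · have hk := parent_mem h
        rw [if_neg (by rintro rfl; exact n4 hk), if_neg fun h => hd k h hk]
        exact hr n2 h

theorem parent?_eq_of_subtreeAt {x k : ℕ} {t l r : BinaryTree ℕ} (ht : Increasing t)
    (hn : (labels t).Nodup) (hk : subtreeAt k t = .node k l r)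
    (h : rootLabel? l = some x ∨ rootLabel? r = some x) : parent? x t = some k := by
  have hmem : ∀ u : BinaryTree ℕ, subtreeAt k u = .node k l r → k ∈ labels u ∧ x ∈ labels u := by
    intro u hu
    have hsub := (subtreeAt_sublist (t := u) k).subset
    rw [hu] at hsub
    refine ⟨hsub (by simp [labels]), hsub ?_⟩
    rcases h with h | h <;> simp [labels, mem_labels_of_rootLabel? h]
  have hkx : k < x := by
    have := increasing_subtreeAt ht k
    rw [hk] at this
    rcases h with h | h
    · exact this.1 x h
    · exact this.2.1 x h
  have hroot : ∀ u : BinaryTree ℕ, Increasing u → k ∈ labels u → rootLabel? u ≠ some x :=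
    fun u hu hku hx => (hu.le_of_mem hx hku).not_gt hkx
  induction t with
  | nil => simp [subtreeAt] at hk
  | node a l' r' ihl ihr =>
    obtain ⟨n1, n2, -, -, hd⟩ := nodup_node hn
    obtain ⟨-, -, h3, h4⟩ := increasing_node.1 ht
    rw [subtreeAt] at hk
    split_ifs at hk with ha hkl
    · obtain ⟨rfl, rfl, rfl⟩ := by simpa using hk
      rw [parent?, if_pos h]
    · have hx := (hmem l' hk).2
      rw [parent?, if_neg, ihl h3 n1 hk, Option.some_or]
      rintro (h' | h')
      · exact hroot l' h3 hkl h'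
      · exact hd x hx (mem_labels_of_rootLabel? h')
    · obtain ⟨hkr, hx⟩ := hmem r' hk
      have hxl : x ∉ labels l' := fun h => hd x h hx
      rw [parent?, if_neg, parent?_eq_none hxl, ihr h4 n2 hk, Option.none_or]
      rintro (h' | h')
      · exact hxl (mem_labels_of_rootLabel? h')
      · exact hroot r' h4 hkr h'

theorem subtreeAt_max {x : ℕ} {t : BinaryTree ℕ} (ht : Increasing t) (hx : x ∈ labels t)
    (hmax : ∀ y ∈ labels t, y ≤ x) : subtreeAt x t = .node x .nil .nil := by
  induction t with
  | nil => simp [labels] at hx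
  | node a l r hl hr =>
    obtain ⟨-, -, h3, h4⟩ := increasing_node.1 ht
    rw [subtreeAt]
    split_ifs with ha h
    · subst ha
      obtain ⟨rfl, rfl⟩ := children_eq_nil ht hmax
      rfl
    · exact hl h3 h fun y hy => hmax y (by simp [labels, hy])
    · simp only [labels, List.mem_append, List.mem_cons] at hx
      exact hr h4 (by tauto) fun y hy => hmax y (by simp [labels, hy])

theorem range'_one_add_two_eq_append (M : ℕ) :
    List.range' 1 (M + 2) = List.range' 1 M ++ [M + 1, M + 2] := by
  rw [List.range'_concat, List.range'_concat]
  simp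
  omega

theorem eoc_map {g : ℕ → ℕ} (hg : StrictMono g) {t : BinaryTree ℕ} (ht : t ≠ .nil) :
    eoc (t.map g) = g (eoc t) := by
  induction t with
  | nil => exact absurd rfl ht
  | node a l r hl hr =>
    have hne {t : BinaryTree ℕ} {b : ℕ} (h : rootLabel? t = some b) : t ≠ .nil :=
      ne_nil_of_mem (mem_labels_of_rootLabel? h)
    rw [BinaryTree.map, eoc, eoc, rootLabel?_map, rootLabel?_map]
    rcases el : rootLabel? l with _ | b <;> rcases er : rootLabel? r with _ | c <;>
      simp only [Option.map_none, Option.map_some]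
    · exact hr (hne er)
    · exact hl (hne el)
    · simp only [hg.lt_iff_lt]
      split_ifs
      · exact hl (hne el)
      · exact hr (hne er)

/-! ### The position of the two largest labels -/

/-- A node labeled `k` with a leaf labeled `x` as its left child and no right child. -/
def hook (k x : ℕ) : BinaryTree ℕ := .node k (.node x .nil .nil) .nil

/-- A node labeled `k` with two leaves labeled `x` and `y` as its children. -/
def fork (k x y : ℕ) : BinaryTree ℕ := .node k (.node x .nil .nil) (.node y .nil .nil)

theorem eq_nil_or_leaf {c : ℕ} {t : BinaryTree ℕ} (ht : Increasing t) (h : ∀ x ∈ labels t, x = c) :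
    t = .nil ∨ t = .node c .nil .nil := by
  rcases t with _ | ⟨a, l, r⟩
  · exact Or.inl rfl
  · obtain rfl : a = c := h a (by simp [labels])
    obtain ⟨rfl, rfl⟩ := children_eq_nil ht fun z hz => (h z hz).le
    exact Or.inr rfl

theorem eq_leaf_of_rootLabel? {x : ℕ} {t : BinaryTree ℕ} (ht : Increasing t)
    (h : rootLabel? t = some x) (hmax : ∀ y ∈ labels t, y ≤ x) : t = .node x .nil .nil := by
  rcases t with _ | ⟨a, l, r⟩
  · simp at h
  · obtain rfl : a = x := by simpa using h
    obtain ⟨rfl, rfl⟩ := children_eq_nil ht hmax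
    rfl

/-- The subtree below the parent `k` of the maximal label when `k` is at least the third largest
label. -/
theorem subtreeAt_parent_max {M k : ℕ} {t : BinaryTree ℕ} (ht : t ∈ secantTrees 1 (M + 2))
    (hk : M ≤ k) (h : parent? (M + 2) t = some k) :
    subtreeAt k t = hook k (M + 2) ∨
      (k = M ∧ (subtreeAt k t = fork M (M + 1) (M + 2) ∨
        subtreeAt k t = fork M (M + 2) (M + 1))) := by
  obtain ⟨hp, hi, hf⟩ := ht
  obtain ⟨l, r, hs, hlr⟩ := subtreeAt_parent (nodup_labels hp) h
  have hsi := increasing_subtreeAt hi k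
  have hsub := subtreeAt_sublist (t := t) k
  have hsn := (nodup_labels hp).sublist hsub
  rw [hs] at hsi hsub hsn
  obtain ⟨h1, h2, h3, h4⟩ := increasing_node.1 hsi
  obtain ⟨-, -, -, -, hd⟩ := nodup_node hsn
  have hle : ∀ x, x ∈ labels l ∨ x ∈ labels r → x ≤ M + 2 := fun x hx => by
    have := (mem_labels_iff hp).1 (hsub.subset (a := x) (by simp [labels]; tauto))
    omega
  have hkl : k = M ∨ k = M + 1 := by
    have := parent?_lt hi h
    omega
  rcases hlr with hl | hr
  · obtain rfl := eq_leaf_of_rootLabel? h3 hl fun y hy => hle y (Or.inl hy)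
    have hx : ∀ x ∈ labels r, x = M + 1 := fun x hx => by
      have e1 := h2 x hx
      have e2 := hle x (Or.inr hx)
      have e3 : x ≠ M + 2 := by
        rintro rfl
        exact hd (M + 2) (by simp [labels]) hx
      omega
    rcases eq_nil_or_leaf h4 hx with rfl | rfl
    · exact Or.inl hs
    · have := h2 (M + 1) (by simp [labels])
      obtain rfl : k = M := by omega
      exact Or.inr ⟨rfl, Or.inr hs⟩
  · obtain rfl := eq_leaf_of_rootLabel? h4 hr fun y hy => hle y (Or.inr hy)
    have hx : ∀ x ∈ labels l, x = M + 1 := fun x hx => by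
      have e1 := h1 x hx
      have e2 := hle x (Or.inl hx)
      have e3 : x ≠ M + 2 := by
        rintro rfl
        exact hd (M + 2) hx (by simp [labels])
      omega
    rcases eq_nil_or_leaf h3 hx with rfl | rfl
    -- A right child without a left sibling fits neither of the two allowed shapes.
    · have := subtreeAt_cases hf k
      simp [hs, EveryNodeFull, FullExceptRightmost] at this
    · have := h1 (M + 1) (by simp [labels])
      obtain rfl : k = M := by omega
      exact Or.inr ⟨rfl, Or.inl hs⟩

theorem parent?_of_hook {M k : ℕ} {t : BinaryTree ℕ} (ht : t ∈ secantTrees 1 (M + 2))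
    (h : subtreeAt k t = hook k (M + 2)) : parent? (M + 2) t = some k :=
  parent?_eq_of_subtreeAt ht.2.1 (nodup_labels ht.1) h (Or.inl rfl)

theorem attach_hook_bijOn {M k : ℕ} (hM : 1 ≤ M) (hk : k = M ∨ k = M + 1) :
    Set.BijOn (attach (hook k (M + 2)))
      {t | (labels t ++ [M + 2, k]).Perm (List.range' 1 (M + 2)) ∧ Increasing t ∧
        FullExceptRightmost t}
      {t ∈ secantTrees 1 (M + 2) | subtreeAt k t = hook k (M + 2)} := by
  have hlab : labels (hook k (M + 2)) = [M + 2, k] := rfl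
  have hfull : FullExceptRightmost (hook k (M + 2)) := by
    simp [hook, FullExceptRightmost, EveryNodeFull]
  have hinc : Increasing (hook k (M + 2)) := by
    simp only [hook, increasing_node, labels, increasing_nil]
    simp
    omega
  refine ⟨?_, (attach_injective _).injOn, ?_⟩
  · rintro t ⟨hp, hi, hf⟩
    have hle : ∀ x ∈ labels t, x ≤ M + 1 ∧ x ≠ k := by
      intro x hx
      have hnd : (labels t ++ [M + 2, k]).Nodup := hp.nodup_iff.2 List.nodup_range'
      have hd := List.disjoint_of_nodup_append hnd hx
      simp only [List.mem_cons, List.not_mem_nil, or_false] at hd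
      have := hp.mem_iff.1 (List.mem_append_left _ hx)
      rw [List.mem_range'_1] at this
      have hne : x ≠ M + 2 := fun h => hd (Or.inl h)
      exact ⟨by omega, fun h => hd (Or.inr h)⟩
    refine ⟨⟨by rwa [labels_attach], increasing_attach hf hi hinc ?_,
      fullExceptRightmost_attach hf hfull⟩, subtreeAt_attach rfl fun h => (hle k h).2 rfl⟩
    -- When `k = M`, the label M + 1 of `t` exceeds `k`, but it is the maximum of `t` and so never
    -- plays the role of `a`.
    intro a ha b hb hab c hc
    have e1 := hle a ha
    have e2 := hle b hb
    simp only [hlab, List.mem_cons, List.not_mem_nil, or_false] at hc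
    omega
  · rintro t ⟨⟨hp, hi, hf⟩, hs⟩
    have hc := subtreeAt_cases hf k
    rw [hs] at hc
    rcases hc with hc | ⟨-, rfl | ⟨t', hf', rfl⟩⟩
    -- The hook is not full, so it sits at the end of the rightmost path; it is not the whole tree
    -- because M + 2 > 2.
    · exact absurd hc hfull.not_everyNodeFull
    · have := hp.length_eq
      simp [hlab] at this
      omega
    · rw [labels_attach] at hp
      refine ⟨t', ⟨hp, ?_, hf'⟩, rfl⟩
      have key : ∀ u : BinaryTree ℕ, Increasing (attach (hook k (M + 2)) u) → Increasing u := by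
        intro u
        induction u with
        | nil => simp
        | node a l r _ ihr =>
          intro h
          obtain ⟨h1, h2, h3, h4⟩ := increasing_node.1 h
          exact increasing_node.2 ⟨h1, fun b hb => h2 b (by simp [labels_attach, hb]), h3, ihr h4⟩
      exact key t' hi

/-! ### The rightmost column -/

theorem secantTrees_eq_setOf_append (M : ℕ) :
    secantTrees 1 M =
      {t | (labels t ++ [M + 2, M + 1]).Perm (List.range' 1 (M + 2)) ∧ Increasing t ∧
        FullExceptRightmost t} := by
  ext t
  simp only [secantTrees, Set.mem_ofPred_eq]
  have : (List.range' 1 (M + 2)).Perm (List.range' 1 M ++ [M + 2, M + 1]) := by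
    rw [range'_one_add_two_eq_append]
    exact List.Perm.append_left _ (List.Perm.swap _ _ _)
  rw [this.congr_right, List.perm_append_right_iff]

theorem f_last_eq {M m : ℕ} (hM : 1 ≤ M) (hM' : Even M) (hm : m ≤ M) :
    f (M + 2) m (M + 1) = rowSum M m := by
  have h := attach_hook_bijOn hM (Or.inr rfl)
  rw [← secantTrees_eq_setOf_append] at h
  have h' := bijOn_sep h (p := fun t => eoc t = m) (q := fun t => eoc t = m) fun t ht => by
    refine eoc_attach (x := M + 1) rfl ?_ ht.2.2 ht.2.1 (by omega)
    rw [← (h.mapsTo ht).2]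
    exact increasing_subtreeAt (h.mapsTo ht).1.2.1 _
  rw [rowSum_eq hM', h'.ncard_eq, f_eq (by simpa [Nat.even_add] using hM')]
  congr 1
  ext t
  constructor
  · rintro ⟨ht, he, hp⟩
    refine ⟨⟨ht, ?_⟩, he⟩
    rcases subtreeAt_parent_max ht (by omega) hp with h | h
    · exact h
    · omega
  · rintro ⟨⟨ht, hs⟩, he⟩
    exact ⟨ht, he, parent?_of_hook ht hs⟩

/-! ### The next to rightmost column -/

/-- The increasing relabeling that skips the label `M`. -/
theorem map_skip_bijOn {M : ℕ} (hM : 1 ≤ M) :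
    ∃ g : ℕ → ℕ, StrictMono g ∧ (∀ x, ∀ m < M, g x = m ↔ x = m) ∧
      Set.BijOn (BinaryTree.map g) (secantTrees 1 M)
        {t | (labels t ++ [M + 2, M]).Perm (List.range' 1 (M + 2)) ∧ Increasing t ∧
          FullExceptRightmost t} := by
  refine ⟨fun x => if x < M then x else x + 1, ?_, ?_, ?_⟩
  · intro a b hab
    simp only
    split_ifs <;> omega
  · intro x m hm
    simp only
    split_ifs <;> omega
  · obtain ⟨K, rfl⟩ : ∃ K, M = K + 1 := ⟨M - 1, by omega⟩
    have hg : StrictMono fun x => if x < K + 1 then x else x + 1 := by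
      intro a b hab
      simp only
      split_ifs <;> omega
    have hmap : (List.range' 1 (K + 1)).map (fun x => if x < K + 1 then x else x + 1) =
        List.range' 1 K ++ [K + 2] := by
      rw [List.range'_concat, List.map_append]
      congr 1
      · conv_rhs => rw [← List.map_id (List.range' 1 K)]
        refine List.map_congr_left fun x hx => ?_
        rw [List.mem_range'_1] at hx
        simp
        omega
      · simp
        omega
    have hperm : (List.range' 1 (K + 1 + 2)).Perm (List.range' 1 K ++ [K + 2] ++ [K + 3, K + 1]) := by
      rw [range'_one_add_two_eq_append, List.range'_concat]
      refine perm_of_count fun a => ?_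
      simp only [List.count_append, List.count_cons, List.count_nil, one_mul, add_assoc,
        Nat.reduceAdd, add_comm 1 K]
      omega
    have h := map_bijOn hg (List.range' 1 (K + 1))
    rw [hmap] at h
    simp only [hperm.congr_right, List.perm_append_right_iff]
    exact h

theorem ncard_hook {M m : ℕ} (hM : 1 ≤ M) (hm : m < M) :
    {t ∈ secantTrees 1 (M + 2) | eoc t = m ∧ subtreeAt M t = hook M (M + 2)}.ncard =
      {t ∈ secantTrees 1 M | eoc t = m}.ncard := by
  obtain ⟨g, hg, hgm, hbij⟩ := map_skip_bijOn hM
  have hatt := attach_hook_bijOn hM (Or.inl rfl)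
  have h1 := bijOn_sep hbij (p := fun t => eoc t = m) (q := fun t => eoc t = m) fun t ht => by
    rw [eoc_map hg ht.2.2.ne_nil, hgm _ m hm]
  have h2 := bijOn_sep hatt (p := fun t => eoc t = m) (q := fun t => eoc t = m) fun t ht => by
    refine eoc_attach (x := M) rfl ?_ ht.2.2 ht.2.1 hm
    rw [← (hatt.mapsTo ht).2]
    exact increasing_subtreeAt (hatt.mapsTo ht).1.2.1 _
  rw [h1.ncard_eq, h2.ncard_eq]
  simp only [Set.mem_ofPred_eq, and_assoc, and_comm (a := eoc _ = m)]

/-- In a tree of size M the label M is a leaf, which may be exchanged for any full increasing `s`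
rooted at M with labels M, M + 1, M + 2. -/
theorem subst_bijOn {M m : ℕ} (hM : 1 ≤ M) (hm : m < M) {s : BinaryTree ℕ}
    (hs : rootLabel? s = some M) (hsi : Increasing s) (hsf : EveryNodeFull s)
    (hsl : (labels s).Perm [M, M + 1, M + 2]) :
    Set.BijOn (subst M s) {t ∈ secantTrees 1 M | eoc t = m}
      {t ∈ secantTrees 1 (M + 2) | eoc t = m ∧ subtreeAt M t = s} := by
  have hleaf : Increasing (.node M .nil .nil) := by simp [increasing_node, labels]
  have hsub : ∀ t ∈ secantTrees 1 M, M ∈ labels t ∧ subtreeAt M t = .node M .nil .nil := by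
    rintro t ⟨hp, hi, hf⟩
    have hMt : M ∈ labels t := (mem_labels_iff hp).2 (by omega)
    exact ⟨hMt, subtreeAt_max hi hMt fun y hy => by have := (mem_labels_iff hp).1 hy; omega⟩
  refine Set.InvOn.bijOn (f' := subst M (.node M .nil .nil)) ⟨?_, ?_⟩ ?_ ?_
  · rintro t ⟨ht, -⟩
    rw [← (hsub t ht).2, subst_subtreeAt hs (nodup_labels ht.1)]
  · rintro t ⟨ht, -, rfl⟩
    exact subst_subtreeAt rfl (nodup_labels ht.1)
  · rintro t ⟨ht, he⟩
    obtain ⟨hMt, hst⟩ := hsub t ht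
    obtain ⟨hp, hi, hf⟩ := ht
    refine ⟨⟨?_, increasing_subst hs hsi hi, fullExceptRightmost_subst hs hsf (nodup_labels hp) hf
      (by simp [hst, EveryNodeFull])⟩, (eoc_subst hs hsi hi hm).2 he, subtreeAt_subst hs hMt⟩
    have h := labels_subst s (nodup_labels hp) hMt
    rw [hst] at h
    refine perm_of_count fun a => ?_
    have h1 := List.perm_iff_count.1 h a
    have h2 := List.perm_iff_count.1 hp a
    have h3 := List.perm_iff_count.1 hsl a
    rw [range'_one_add_two_eq_append]
    simp only [labels, List.count_append, List.count_cons, List.count_nil, List.nil_append]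
      at h1 h2 h3 ⊢
    omega
  · rintro t ⟨⟨hp, hi, hf⟩, he, hst⟩
    have hMt : M ∈ labels t := (mem_labels_iff hp).2 (by omega)
    refine ⟨⟨?_, increasing_subst rfl hleaf hi, fullExceptRightmost_subst rfl
      (by simp [EveryNodeFull]) (nodup_labels hp) hf (by rwa [hst])⟩,
      (eoc_subst rfl hleaf hi hm).2 he⟩
    have h := labels_subst (.node M .nil .nil) (nodup_labels hp) hMt
    rw [hst] at h
    refine perm_of_count fun a => ?_
    have h1 := List.perm_iff_count.1 h a
    have h2 := List.perm_iff_count.1 hp a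
    have h3 := List.perm_iff_count.1 hsl a
    rw [range'_one_add_two_eq_append] at h2
    simp only [labels, List.count_append, List.count_cons, List.count_nil, List.nil_append]
      at h1 h2 h3 ⊢
    omega

theorem f_next_to_last_eq {M m : ℕ} (hM' : Even M) (hm : m < M) :
    f (M + 2) m M = 3 * rowSum M m := by
  have hM : 1 ≤ M := by omega
  have hE : Even (M + 2) := by simpa [Nat.even_add] using hM'
  rw [rowSum_eq hM', f_eq hE]
  set F := {t ∈ secantTrees 1 (M + 2) | eoc t = m ∧ parent? (M + 2) t = some M} with hF
  have hfin : F.Finite := (finite_secantTrees hE).subset fun _ h => h.1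
  -- Prescribing the subtree at M already determines the parent of M + 2, so that condition drops
  -- out.
  have hfiber : ∀ l r, (rootLabel? l = some (M + 2) ∨ rootLabel? r = some (M + 2)) →
      {t ∈ F | subtreeAt M t = .node M l r} =
        {t ∈ secantTrees 1 (M + 2) | eoc t = m ∧ subtreeAt M t = .node M l r} := by
    intro l r hlr
    ext t
    constructor
    · rintro ⟨⟨ht, he, -⟩, hs⟩
      exact ⟨ht, he, hs⟩
    · rintro ⟨ht, he, hs⟩
      exact ⟨⟨ht, he, parent?_eq_of_subtreeAt ht.2.1 (nodup_labels ht.1) hs hlr⟩, hs⟩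
  have hsum := sum_ncard_fiber hfin
    {hook M (M + 2), fork M (M + 1) (M + 2), fork M (M + 2) (M + 1)} (subtreeAt M)
    Function.injective_id fun t ht => ⟨_, by
      have := subtreeAt_parent_max ht.1 le_rfl ht.2.2
      simp only [Finset.mem_insert, Finset.mem_singleton]
      tauto, rfl⟩
  have h1 : {t ∈ F | subtreeAt M t = hook M (M + 2)}.ncard =
      {t ∈ secantTrees 1 M | eoc t = m}.ncard := by
    rw [← ncard_hook hM hm]
    exact congrArg Set.ncard (hfiber _ _ (Or.inl rfl))
  have h2 : {t ∈ F | subtreeAt M t = fork M (M + 1) (M + 2)}.ncard =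
      {t ∈ secantTrees 1 M | eoc t = m}.ncard := by
    rw [(subst_bijOn hM hm (s := fork M (M + 1) (M + 2)) rfl
      (by simp [fork, Increasing]) (by simp [fork, EveryNodeFull])
      (List.Perm.swap _ _ _)).ncard_eq]
    exact congrArg Set.ncard (hfiber _ _ (Or.inr rfl))
  have h3 : {t ∈ F | subtreeAt M t = fork M (M + 2) (M + 1)}.ncard =
      {t ∈ secantTrees 1 M | eoc t = m}.ncard := by
    rw [(subst_bijOn hM hm (s := fork M (M + 2) (M + 1)) rfl
      (by simp [fork, Increasing]) (by simp [fork, EveryNodeFull])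
      ((List.Perm.swap _ _ _).trans ((List.Perm.swap _ _ _).cons _))).ncard_eq]
    exact congrArg Set.ncard (hfiber _ _ (Or.inl rfl))
  rw [← hsum, Finset.sum_insert (by simp [hook, fork]), Finset.sum_insert (by simp [fork]),
    Finset.sum_singleton]
  simp only [id]
  rw [h1, h2, h3]
  ring

theorem rowSum_succ_eq_colSum {M : ℕ} (hM : Even M) (k : ℕ) :
    rowSum M (k + 1) = colSum M k := by
  rw [rowSum_eq hM, colSum_eq hM, ncard_eoc_eq_ncard_parent]

end SecantTree

theorem theorem1p2 (n : ℕ) (hn : 2 ≤ n) :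
    (∀ k : ℕ, 3 ≤ k → k ≤ 2 * n - 1 →
      SecantTree.f (2 * n) 2 k = SecantTree.colSum (2 * n - 2) (k - 2) ∧
      SecantTree.colSum (2 * n - 2) (k - 2) = SecantTree.rowSum (2 * n - 2) (k - 1)) ∧
    (∀ k : ℕ, 4 ≤ k → k ≤ 2 * n - 1 →
      SecantTree.f (2 * n) 3 k = 3 * SecantTree.f (2 * n) 2 k) ∧
    (∀ m : ℕ, 2 ≤ m → m ≤ 2 * n - 2 →
      SecantTree.f (2 * n) m (2 * n - 1) = SecantTree.rowSum (2 * n - 2) m ∧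
      SecantTree.rowSum (2 * n - 2) m = SecantTree.colSum (2 * n - 2) (m - 1)) ∧
    (∀ m : ℕ, 2 ≤ m → m ≤ 2 * n - 3 →
      SecantTree.f (2 * n) m (2 * n - 2) = 3 * SecantTree.f (2 * n) m (2 * n - 1)) := by
  -- Working with M = 2n - 2 removes most truncated subtractions.
  obtain ⟨M, hM⟩ : ∃ M, 2 * n = M + 2 := ⟨2 * n - 2, by omega⟩
  have hM2 : 2 ≤ M := by omega
  have hE : Even M := ⟨n - 1, by omega⟩
  rw [hM, show M + 2 - 2 = M by omega, show M + 2 - 1 = M + 1 by omega]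
  refine ⟨fun k hk _ => ?_, fun k hk _ => SecantTree.f_three_eq hM2 hE hk, fun m hm hm' => ?_,
    fun m _ hm' => ?_⟩
  · obtain ⟨j, rfl⟩ : ∃ j, k = j + 2 := ⟨k - 2, by omega⟩
    exact ⟨SecantTree.f_two_eq_colSum hM2 hE j, (SecantTree.rowSum_succ_eq_colSum hE j).symm⟩
  · obtain ⟨j, rfl⟩ : ∃ j, m = j + 1 := ⟨m - 1, by omega⟩
    exact ⟨SecantTree.f_last_eq (by omega) hE hm', SecantTree.rowSum_succ_eq_colSum hE j⟩
  -- Both columns are compared through the row sum for M.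
  · rw [SecantTree.f_next_to_last_eq hE (by omega), SecantTree.f_last_eq (by omega) hE (by omega)]
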